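/- Let $K$ be a field, $q\in K^\times$, and $m,n,k\ge 0$. For indices of type $m|n$ put $\bar i=0$ if $i\le m$, $\bar i=1$ if $m<i\le m+n$, and let $\varepsilon(i-j)\in\{1,0,-1\}$ be the sign of $i-j$. A matrix $A=(A_{ij})_{1\le i,j\le m+n}$ over an associative algebra, $A_{ij}$ having parity $\bar i+\bar j$, is called $q$-super Manin of type $m|n$ if $$\begin{aligned} &A_{ij}^2=0\quad(\bar i=1,\ \bar j=0),\\ &A_{ik}A_{il}=q^{\varepsilon(l-k)}(-1)^{(\bar k+1)(\bar l+1)}A_{il}A_{ik}\quad(\bar i=1),\\ &A_{ik}A_{jk}=q^{\varepsilon(i-j)}(-1)^{\bar i\bar j}A_{jk}A_{ik}\quad(\bar k=0),\\ &A_{ij}A_{kl}-q^{\varepsilon(i-k)+\varepsilon(l-j)}(-1)^{(\bar i+\bar j)(\bar k+\bar l)}A_{kl}A_{ij}\\ &\qquad=q^{\varepsilon(i-k)}(-1)^{\bar i\bar k+\bar j\bar k+\bar i\bar j}A_{kj}A_{il}-q^{\varepsilon(l-j)}(-1)^{\bar j\bar k+\bar j\bar l+\bar k\bar l}A_{il}A_{kj}.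 \end{aligned}$$ The supertranspose is $(A^{st})_{ij}=(-1)^{\bar i(\bar i+\bar j)}A_{ji}$. Call $(A,B)$ an antipodal pair of type $m|n$ if $A$ is $q$-super Manin, $B$ is $q^{-1}$-super Manin, $AB=BA=I$ and $A^{st}B^{st}=B^{st}A^{st}=I$. Let $\widetilde{\mathcal M}_{m|n}$ be the superalgebra generated by the entries of two matrices $M$, $M^{-1}$ subject to the relations that $(M,M^{-1})$ is an antipodal pair of type $m|n$; let $\omega=\omega_{m|n}$ be its anti-isomorphism (antipode), i.e. the linear map with $\omega(1)=1$, $\omega(M_{ij})=(M^{-1})_{ij}$, $\omega((M^{-1})_{ij})=M_{ij}$ and $\omega(uv)=(-1)^{\bar u\bar v}\omega(v)\omega(u)$ for homogeneous $u,v$. For an $r\times r$ matrix $A$ put $\det_q(A)=\sum_{\sigma\in\mathfrak S_r}(-q)^{-l(\sigma)}A_{\sigma(1),1}\cdots A_{\sigma(r),r}$, where $l(\sigma)$ is the number of inversions. The quantum Berezinian of $M$ is $$\mathrm{Ber}_q(M)=\sum_{\sigma\in\mathfrak S_m}(-q)^{-l(\sigma)}M_{\sigma(1),1}\cdots M_{\sigma(m),m}\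 \sum_{\rho\in\mathfrak S_n}(-q)^{-l(\rho)}(M^{-1})_{m+1,m+\rho(1)}\cdots(M^{-1})_{m+n,m+\rho(n)}.$$ Write $M_{k+m|n}$ for the generator matrix of $\widetilde{\mathcal M}_{k+m|n}$ and, for entries of this matrix, simply $M_{ab}$. Let $\mathcal L$ be the universal superalgebra over $\widetilde{\mathcal M}_{k+m|n}$ to which $\omega_{k+m|n}$ extends as such an anti-isomorphism of square one, and in which there is a matrix $Y$ with $Y_{ij}$ of parity $\bar i+\bar j$ such that $(X,Y)$, $X=(M_{k+i,k+j})_{1\le i,j\le m+n}$, is an antipodal pair of type $m|n$. (Explicitly, $\mathcal L$ is obtained from $\widetilde{\mathcal M}_{k+m|n}$ by adjoining the entries of two matrices $Y$, $Z$ subject to the relations that $(X,Y)$ and $(Z,W)$, $W=((M^{-1})_{k+i,k+j})_{1\le i,j\le m+n}$, are antipodal pairs of type $m|n$; $\omega$ exchanges $Y_{ij}$ and $Z_{ij}$.) Let $\phi_k:\widetilde{\mathcal M}_{m|n}\to\mathcal L$ be the algebra homomorphism with $\phi_k(M_{ij})=M_{k+i,k+j}$ and $\phi_k((M^{-1})_{ij})=Y_{ij}$,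 and put $$\psi_k=\omega\circ\phi_k\circ\omega_{m|n}:\widetilde{\mathcal M}_{m|n}\to\mathcal L .$$ Then, in $\mathcal L$, the matrix $M^{1,\ldots,k}_{1,\ldots,k}=(M_{ab})_{1\le a,b\le k}$ is invertible, $\psi_k$ sends generators to quasideterminants, $$\psi_k(M_{ij})=\left|\begin{array}{cccc}M_{11}&\cdots&M_{1k}&M_{1,k+j}\\ \vdots&&\vdots&\vdots\\ M_{k1}&\cdots&M_{kk}&M_{k,k+j}\\ M_{k+i,1}&\cdots&M_{k+i,k}&\boxed{M_{k+i,k+j}}\end{array}\right| =M_{k+i,k+j}-\sum_{a,b=1}^k M_{k+i,a}\,\bigl((M^{1,\ldots,k}_{1,\ldots,k})^{-1}\bigr)_{ab}\,M_{b,k+j}\qquad(1\le i,j\le m+n),$$ the element $\det_q(M^{1,\ldots,k}_{1,\ldots,k})$ is invertible, and $$\psi_k(\mathrm{Ber}_q(M))={\det}_q(M^{1,\ldots,k}_{1,\ldots,k})^{-1}\,\mathrm{Ber}_q(M_{k+m|n}).$$ -/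

import Mathlib

noncomputable section

namespace SuperManin

/-- The parity of the index `i` (counted from zero) of a super space with `m` even coordinates
placed first: `0` for `i < m` and `1` otherwise. -/
def par (m : ℕ) {N : ℕ} (i : Fin N) : ℕ := if i.val < m then 0 else 1

/-- The symbol `ε(i - j)`: the sign of `i - j`. -/
def eps {N : ℕ} (i j : Fin N) : ℤ := if j < i then 1 else if i < j then -1 else 0

/-- The number of inversions of a permutation. -/
def invLength {r : ℕ} (σ : Equiv.Perm (Fin r)) : ℕ :=
  (Finset.univ.filter fun p : Fin r × Fin r => p.1 < p.2 ∧ σ p.2 < σ p.1).card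

section Algebraic

variable {K : Type*} [Field K] {F : Type*} [Ring F] [Algebra K F]

/-- The scalar `q ^ a * (-1) ^ s`. -/
def qs (q : Kˣ) (a : ℤ) (s : ℕ) : K := ((q ^ a : Kˣ) : K) * (-1) ^ s

/-- The supertranspose: `(A^st)_{ij} = (-1)^{i(i+j)} A_{ji}` (parities in the exponent). -/
def superTranspose (m : ℕ) {N : ℕ} (A : Matrix (Fin N) (Fin N) F) : Matrix (Fin N) (Fin N) F :=
  Matrix.of fun i j => (-1) ^ (par m i * (par m i + par m j)) * A j i

/-- The defining relations of the right quantum superalgebra, i.e. of a `q`-super Manin matrix,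
for the matrix `A` (the pairs `x, y` are the two sides of the relations). -/
inductive ManinRel (q : Kˣ) (m n : ℕ) (A : Matrix (Fin (m + n)) (Fin (m + n)) F) : F → F → Prop
  | sq (i j : Fin (m + n)) (hi : par m i = 1) (hj : par m j = 0) :
      ManinRel q m n A (A i j * A i j) 0
  | row (i k l : Fin (m + n)) (hi : par m i = 1) :
      ManinRel q m n A
        (A i k * A i l - qs q (eps l k) ((par m k + 1) * (par m l + 1)) • (A i l * A i k)) 0
  | col (i j k : Fin (m + n)) (hk : par m k = 0) :
      ManinRel q m n A
        (A i k * A j k - qs q (eps i j) (par m i * par m j) • (A j k * A i k)) 0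
  | cross (i j k l : Fin (m + n)) :
      ManinRel q m n A
        (A i j * A k l - qs q (eps i k + eps l j) ((par m i + par m j) * (par m k + par m l)) •
          (A k l * A i j))
        (qs q (eps i k) (par m i * par m k + par m j * par m k + par m i * par m j) •
            (A k j * A i l) -
          qs q (eps l j) (par m j * par m k + par m j * par m l + par m k * par m l) •
            (A i l * A k j))

/-- The defining relations of the Hopf superalgebra with involutive antipode, for a matrix `A` and
its antipode matrix `B`: `A` is a `q`-super Manin matrix, `B` is a `q⁻¹`-super Manin matrix,
`A` and `B` are mutually inverse, and so are their supertransposes. -/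
inductive HopfRel (q : Kˣ) (m n : ℕ) (A B : Matrix (Fin (m + n)) (Fin (m + n)) F) :
    F → F → Prop
  | manin {x y : F} (h : ManinRel q m n A x y) : HopfRel q m n A B x y
  | manin_inv {x y : F} (h : ManinRel q⁻¹ m n B x y) : HopfRel q m n A B x y
  | mul_inv (i j : Fin (m + n)) :
      HopfRel q m n A B ((A * B) i j) ((1 : Matrix (Fin (m + n)) (Fin (m + n)) F) i j)
  | inv_mul (i j : Fin (m + n)) :
      HopfRel q m n A B ((B * A) i j) ((1 : Matrix (Fin (m + n)) (Fin (m + n)) F) i j)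
  | st_inv_mul (i j : Fin (m + n)) :
      HopfRel q m n A B ((superTranspose m B * superTranspose m A) i j)
        ((1 : Matrix (Fin (m + n)) (Fin (m + n)) F) i j)
  | st_mul_inv (i j : Fin (m + n)) :
      HopfRel q m n A B ((superTranspose m A * superTranspose m B) i j)
        ((1 : Matrix (Fin (m + n)) (Fin (m + n)) F) i j)

/-- The coefficient `(-q)^{-l(σ)}`. -/
def permCoeff (q : Kˣ) {r : ℕ} (σ : Equiv.Perm (Fin r)) : K :=
  (((-q) ^ (-(invLength σ : ℤ)) : Kˣ) : K)

/-- The quantum determinant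
`det_q A = ∑_σ (-q)^{-l(σ)} A_{σ(1),1} A_{σ(2),2} ⋯ A_{σ(r),r}` (ordered products). -/
def qDet (q : Kˣ) {r : ℕ} (A : Matrix (Fin r) (Fin r) F) : F :=
  ∑ σ : Equiv.Perm (Fin r), permCoeff q σ • (List.ofFn fun i => A (σ i) i).prod

/-- The row version `∑_ρ (-q)^{-l(ρ)} B_{1,ρ(1)} B_{2,ρ(2)} ⋯ B_{r,ρ(r)}` (ordered products). -/
def qDetRow (q : Kˣ) {r : ℕ} (B : Matrix (Fin r) (Fin r) F) : F :=
  ∑ ρ : Equiv.Perm (Fin r), permCoeff q ρ • (List.ofFn fun i => B i (ρ i)).prod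

/-- The quantum Berezinian of a matrix `A` with inverse `B`. -/
def qBer (q : Kˣ) (m n : ℕ) (A B : Matrix (Fin (m + n)) (Fin (m + n)) F) : F :=
  qDet q (A.submatrix (Fin.castAdd n) (Fin.castAdd n)) *
    qDetRow q (B.submatrix (Fin.natAdd m) (Fin.natAdd m))

/-- The quasideterminant `|A|_{ij} = a_{ij} - r (A^{ij})⁻¹ c`, where `A^{ij}` is `A` without row
`i` and column `j`, `r` is row `i` without its entry in column `j`, and `c` is column `j` without
its entry in row `i`. It is meaningful when `A^{ij}` is invertible. -/
def quasidet {r : ℕ} (A : Matrix (Fin (r + 1)) (Fin (r + 1)) F) (i j : Fin (r + 1)) : F :=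
  A i j - ∑ a : Fin r, ∑ b : Fin r, A i (j.succAbove a) *
    Ring.inverse (A.submatrix i.succAbove j.succAbove) a b * A (i.succAbove b) j

/-- `x ↦ τ^p(x) * c`. With `τ` the parity automorphism and `c` of parity `p` this is
`x ↦ (-1)^{p·|x|} x * c`. -/
def superMulRight (τ : F →ₐ[K] F) (p : ℕ) (c : F) : Module.End K F :=
  LinearMap.mulRight K c ∘ₗ ((τ ^ p : F →ₐ[K] F) : F →ₗ[K] F)

theorem superMulRight_apply (τ : F →ₐ[K] F) (p : ℕ) (c x : F) :
    superMulRight τ p c x = (τ ^ p) x * c := rfl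

end Algebraic

section Descent

variable {K : Type*} [Field K] {F : Type*} [Ring F] [Algebra K F]
variable {R : Type*} [Ring R] [Algebra K R]

theorem par_cases (m : ℕ) {N : ℕ} (i : Fin N) : par m i = 0 ∨ par m i = 1 := by
  unfold par; split <;> simp

theorem neg_one_pow_mul_smul (s : ℕ) (x : R) : ((-1 : R) ^ s) * x = ((-1 : K) ^ s) • x := by
  rcases Nat.even_or_odd s with h | h <;> simp [h.neg_one_pow]

/-- A homomorphism carrying `A` to `A'` carries the Manin relations of `A` to those of `A'`. -/
theorem ManinRel.map {q : Kˣ} {m n : ℕ} {A : Matrix (Fin (m + n)) (Fin (m + n)) F}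
    {A' : Matrix (Fin (m + n)) (Fin (m + n)) R} (f : F →ₐ[K] R)
    (hA : ∀ i j, f (A i j) = A' i j) {x y : F} (h : ManinRel q m n A x y) :
    ManinRel q m n A' (f x) (f y) := by
  cases h with
  | sq i j hi hj => simpa [hA] using ManinRel.sq (q := q) (A := A') i j hi hj
  | row i k l hi => simpa [hA] using ManinRel.row (q := q) (A := A') i k l hi
  | col i j k hk => simpa [hA] using ManinRel.col (q := q) (A := A') i j k hk
  | cross i j k l => simpa [hA] using ManinRel.cross (q := q) (A := A') i j k l

theorem map_one_apply {N : ℕ} (f : F →ₐ[K] R) (i j : Fin N) :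
    f ((1 : Matrix (Fin N) (Fin N) F) i j) = (1 : Matrix (Fin N) (Fin N) R) i j := by
  by_cases h : i = j <;> simp [Matrix.one_apply, h]

/-- A homomorphism carrying `A, B` to `A', B'` carries the Hopf relations to the Hopf relations. -/
theorem HopfRel.map {q : Kˣ} {m n : ℕ} {A B : Matrix (Fin (m + n)) (Fin (m + n)) F}
    {A' B' : Matrix (Fin (m + n)) (Fin (m + n)) R} (f : F →ₐ[K] R)
    (hA : ∀ i j, f (A i j) = A' i j) (hB : ∀ i j, f (B i j) = B' i j)
    {x y : F} (h : HopfRel q m n A B x y) : HopfRel q m n A' B' (f x) (f y) := by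
  cases h with
  | manin h => exact .manin (h.map f hA)
  | manin_inv h => exact .manin_inv (h.map f hB)
  | mul_inv i j =>
    rw [map_one_apply]
    simpa [Matrix.mul_apply, hA, hB] using HopfRel.mul_inv (q := q) (A := A') (B := B') i j
  | inv_mul i j =>
    rw [map_one_apply]
    simpa [Matrix.mul_apply, hA, hB] using HopfRel.inv_mul (q := q) (A := A') (B := B') i j
  | st_inv_mul i j =>
    rw [map_one_apply]
    simpa [Matrix.mul_apply, hA, hB, superTranspose] using
      HopfRel.st_inv_mul (q := q) (A := A') (B := B') i j
  | st_mul_inv i j =>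
    rw [map_one_apply]
    simpa [Matrix.mul_apply, hA, hB, superTranspose] using
      HopfRel.st_mul_inv (q := q) (A := A') (B := B') i j


theorem qs_inv (q : Kˣ) (a : ℤ) (s : ℕ) : qs q⁻¹ a s = ((q ^ a : Kˣ) : K)⁻¹ * (-1) ^ s := by
  simp [qs]

theorem qs_add (q : Kˣ) (a b : ℤ) (s : ℕ) :
    qs q (a + b) s = ((q ^ a : Kˣ) : K) * ((q ^ b : Kˣ) : K) * (-1) ^ s := by
  simp [qs, zpow_add]

theorem superMulRight_mul (τ : R →ₐ[K] R) (p p' : ℕ) (c c' : R)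
    (hc : τ c' = ((-1 : K) ^ p') • c') :
    superMulRight τ p c * superMulRight τ p' c' =
      ((-1 : K) ^ (p * p')) • superMulRight τ (p + p') (c' * c) := by
  have hp : (τ ^ p) c' = ((-1 : K) ^ (p * p')) • c' := by
    induction p with
    | zero => simp
    | succ p ih =>
      rw [pow_succ, AlgHom.mul_apply, hc, map_smul, ih, smul_smul, ← pow_add]
      congr 2; ring
  ext x
  simp only [Module.End.mul_apply, superMulRight_apply, LinearMap.smul_apply, map_mul, hp]
  rw [pow_add, AlgHom.mul_apply]
  simp [mul_assoc]

theorem superMulRight_zero (τ : R →ₐ[K] R) (p : ℕ) : superMulRight τ p 0 = 0 := by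
  ext x; simp [superMulRight_apply]

theorem superMulRight_smul (τ : R →ₐ[K] R) (p : ℕ) (r : K) (c : R) :
    superMulRight τ p (r • c) = r • superMulRight τ p c := by
  ext x; simp [superMulRight_apply]

theorem superMulRight_sub (τ : R →ₐ[K] R) (p : ℕ) (c c' : R) :
    superMulRight τ p (c - c') = superMulRight τ p c - superMulRight τ p c' := by
  ext x; simp [superMulRight_apply, mul_sub]

theorem superMulRight_sum {ι : Type*} (s : Finset ι) (τ : R →ₐ[K] R) (p : ℕ) (c : ι → R) :
    superMulRight τ p (∑ i ∈ s, c i) = ∑ i ∈ s, superMulRight τ p (c i) := by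
  ext x; simp [superMulRight_apply, Finset.mul_sum]

theorem flip_two {V : Type*} [AddCommGroup V] [Module K V] {x y : V} {a s t : K} (ha : a ≠ 0)
    (hs : s * s = 1) (h : x - (a⁻¹ * s) • y = 0) : t • y - (a * s) • t • x = 0 := by
  rw [sub_eq_zero] at h
  rw [h, smul_smul, smul_smul, ← sub_smul, mul_assoc (a * s)]
  have : t - a * s * (t * (a⁻¹ * s)) = t * (1 - (a * a⁻¹) * (s * s)) := by ring
  rw [this, hs, mul_inv_cancel₀ ha]; simp

theorem flip_four {V : Type*} [AddCommGroup V] [Module K V] {x y u v : V} {a b s s₁ s₂ s₃ : K}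
    (ha : a ≠ 0) (hb : b ≠ 0) (hs : s * s = 1) (h₁ : s₁ * s₃ = s₂) (h₂ : s₂ * s₃ = s₁)
    (h : x - (a⁻¹ * b⁻¹ * s) • y = (a⁻¹ * s₁) • u - (b⁻¹ * s₂) • v) :
    s • y - (a * b * s) • s • x = (a * s₁) • s₃ • v - (b * s₂) • s₃ • u := by
  rw [sub_eq_iff_eq_add] at h
  rw [h]
  have e₁ : a * b * s * s = a * b := by rw [mul_assoc, hs, mul_one]
  have e₂ : a * b * (a⁻¹ * b⁻¹ * s) = s := by field_simp
  have e₃ : a * b * (a⁻¹ * s₁) = b * s₁ := by field_simp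
  have e₄ : a * b * (b⁻¹ * s₂) = a * s₂ := by field_simp
  rw [smul_smul (a * b * s), e₁, smul_add, smul_sub, smul_smul, smul_smul, smul_smul, e₂, e₃, e₄,
    smul_smul, smul_smul, mul_assoc, h₁, mul_assoc, h₂]
  abel

theorem sign_mul_self (s : ℕ) : ((-1 : K) ^ s) * (-1) ^ s = 1 := by
  rw [← mul_pow]; simp

/-- A super antihomomorphism carries the `q`-Manin relations to the `q⁻¹`-Manin relations. -/
theorem ManinRel.anti {q : Kˣ} {m n : ℕ} {A : Matrix (Fin (m + n)) (Fin (m + n)) F}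
    {A' : Matrix (Fin (m + n)) (Fin (m + n)) R} (τ : R →ₐ[K] R) (ρ : F →ₐ[K] Module.End K R)
    (hτ : ∀ i j, τ (A' i j) = ((-1 : K) ^ (par m i + par m j)) • A' i j)
    (hA : ∀ i j, ρ (A i j) = superMulRight τ (par m i + par m j) (A' i j))
    (hR : ∀ x y : R, ManinRel q⁻¹ m n A' x y → x = y) {x y : F} (h : ManinRel q m n A x y) :
    ρ x = ρ y := by
  have key : ∀ i j k l, ρ (A i j) * ρ (A k l) =
      ((-1 : K) ^ ((par m i + par m j) * (par m k + par m l))) •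
        superMulRight τ (par m i + par m j + par m k + par m l) (A' k l * A' i j) := by
    intro i j k l
    rw [hA, hA, superMulRight_mul _ _ _ _ _ (hτ k l), add_assoc (par m i + par m j)]
  cases h with
  | sq i j hi hj =>
    have h := hR _ _ (.sq i j hi hj)
    rw [map_mul, key, h, superMulRight_zero, smul_zero, map_zero]
  | row i k l hi =>
    have h := hR _ _ (.row i k l hi)
    rw [qs_inv] at h
    have g := flip_two (t := (-1 : K) ^ ((par m i + par m k) * (par m i + par m l)))
      (Units.ne_zero _) (sign_mul_self _) h
    simp only [map_sub, map_smul, map_mul, key, map_zero]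
    rw [show par m i + par m l + par m i + par m k = par m i + par m k + par m i + par m l by ring,
      mul_comm (par m i + par m l)]
    simp only [← superMulRight_smul, ← superMulRight_sub]
    rw [← superMulRight_zero τ (par m i + par m k + par m i + par m l), ← g]
    rfl
  | col i j k hk =>
    have h := hR _ _ (.col i j k hk)
    rw [qs_inv] at h
    have g := flip_two (t := (-1 : K) ^ ((par m i + par m k) * (par m j + par m k)))
      (Units.ne_zero _) (sign_mul_self _) h
    simp only [map_sub, map_smul, map_mul, key, map_zero]
    rw [show par m j + par m k + par m i + par m k = par m i + par m k + par m j + par m k by ring,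
      mul_comm (par m j + par m k)]
    simp only [← superMulRight_smul, ← superMulRight_sub]
    rw [← superMulRight_zero τ (par m i + par m k + par m j + par m k), ← g]
    rfl
  | cross i j k l =>
    have h := hR _ _ (.cross i j k l)
    rw [qs_inv, qs_inv, qs_inv, zpow_add, Units.val_mul, mul_inv] at h
    have g := flip_four (s₃ := (-1 : K) ^ ((par m k + par m j) * (par m i + par m l)))
      (Units.ne_zero _) (Units.ne_zero _) (sign_mul_self _)
      (by rcases par_cases m i with hi | hi <;> rcases par_cases m j with hj | hj <;>
            rcases par_cases m k with hk | hk <;> rcases par_cases m l with hl | hl <;>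
            norm_num [hi, hj, hk, hl])
      (by rcases par_cases m i with hi | hi <;> rcases par_cases m j with hj | hj <;>
            rcases par_cases m k with hk | hk <;> rcases par_cases m l with hl | hl <;>
            norm_num [hi, hj, hk, hl]) h
    simp only [map_sub, map_smul, map_mul, key]
    rw [show par m k + par m l + par m i + par m j = par m i + par m j + par m k + par m l by ring,
      show par m k + par m j + par m i + par m l = par m i + par m j + par m k + par m l by ring,
      show par m i + par m l + par m k + par m j = par m i + par m j + par m k + par m l by ring,
      mul_comm (par m k + par m l), mul_comm (par m i + par m l)]
    simp only [← superMulRight_smul, ← superMulRight_sub]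
    rw [qs_add, show qs q (eps i k) _ = ((q ^ eps i k : Kˣ) : K) * _ from rfl,
      show qs q (eps l j) _ = ((q ^ eps l j : Kˣ) : K) * _ from rfl, g]

/-- A super antihomomorphism carries the Hopf relations for `A, B` to those for the images in
reversed order. -/
theorem HopfRel.anti {q : Kˣ} {m n : ℕ} {A B : Matrix (Fin (m + n)) (Fin (m + n)) F}
    {A' B' : Matrix (Fin (m + n)) (Fin (m + n)) R} (τ : R →ₐ[K] R) (hττ : τ ^ 2 = 1)
    (ρ : F →ₐ[K] Module.End K R)
    (hτA : ∀ i j, τ (A' i j) = ((-1 : K) ^ (par m i + par m j)) • A' i j)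
    (hτB : ∀ i j, τ (B' i j) = ((-1 : K) ^ (par m i + par m j)) • B' i j)
    (hA : ∀ i j, ρ (A i j) = superMulRight τ (par m i + par m j) (A' i j))
    (hB : ∀ i j, ρ (B i j) = superMulRight τ (par m i + par m j) (B' i j))
    (hR : ∀ x y : R, HopfRel q m n B' A' x y → x = y) {x y : F} (h : HopfRel q m n A B x y) :
    ρ x = ρ y := by
  have hsq : ∀ p c, superMulRight τ (p + 2) c = superMulRight τ p c := by
    intro p c; unfold superMulRight; rw [pow_add, hττ, mul_one]
  have hpar : ∀ p (j : Fin (m + n)) r c, superMulRight τ (p + par m j + par m j + r) c =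
      superMulRight τ (p + r) c := by
    intro p j r c
    rcases par_cases m j with h | h
    · simp [h]
    · rw [h, show p + 1 + 1 + r = p + r + 2 by ring, hsq]
  have hone : ∀ i j : Fin (m + n), superMulRight τ (par m i + par m j)
      ((1 : Matrix (Fin (m + n)) (Fin (m + n)) R) i j) =
      (1 : Matrix (Fin (m + n)) (Fin (m + n)) (Module.End K R)) i j := by
    intro i j
    by_cases h : i = j
    · subst h
      rw [Matrix.one_apply_eq, Matrix.one_apply_eq]
      have := hpar 0 i 0 (1 : R)
      simp only [zero_add, add_zero] at this
      rw [this]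
      ext x; simp [superMulRight_apply]
    · rw [Matrix.one_apply_ne h, Matrix.one_apply_ne h, superMulRight_zero]
  have kmul : ∀ (C D C' D' : Matrix (Fin (m + n)) (Fin (m + n)) _)
      (_ : ∀ i j, τ (D' i j) = ((-1 : K) ^ (par m i + par m j)) • D' i j)
      (_ : ∀ i j, ρ (C i j) = superMulRight τ (par m i + par m j) (C' i j))
      (_ : ∀ i j, ρ (D i j) = superMulRight τ (par m i + par m j) (D' i j))
      (_ : superTranspose m D' * superTranspose m C' = 1) (i l : Fin (m + n)),
      ρ ((C * D) i l) = ρ ((1 : Matrix (Fin (m + n)) (Fin (m + n)) F) i l) := by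
    intro C D C' D' hτ hC hD h i l
    have hj : ∀ j, ρ (C i j * D j l) = superMulRight τ (par m i + par m l)
        (((-1 : K) ^ (par m l + par m i * par m l)) •
          (superTranspose m D' l j * superTranspose m C' j i)) := by
      intro j
      rw [map_mul, hC, hD, superMulRight_mul _ _ _ _ _ (hτ j l), ← add_assoc, ← superMulRight_smul]
      rw [show par m i + par m j + par m j + par m l = par m i + par m j + par m j + (par m l) from
        rfl, hpar]
      congr 1
      simp only [superTranspose, Matrix.of_apply, neg_one_pow_mul_smul (K := K), smul_mul_assoc,
        mul_smul_comm, smul_smul]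
      congr 1
      rcases par_cases m i with hi | hi <;> rcases par_cases m j with hj | hj <;>
        rcases par_cases m l with hl | hl <;> norm_num [hi, hj, hl]
    rw [Matrix.mul_apply, map_sum, Finset.sum_congr rfl fun j _ => hj j, ← superMulRight_sum,
      ← Finset.smul_sum, ← Matrix.mul_apply, h, map_one_apply, ← hone]
    congr 1
    by_cases hil : i = l
    · subst hil
      rw [Matrix.one_apply_eq]
      rcases par_cases m i with hi | hi <;> norm_num [hi]
    · rw [Matrix.one_apply_ne hil, Matrix.one_apply_ne (Ne.symm hil), smul_zero]
  have kst : ∀ (C D C' D' : Matrix (Fin (m + n)) (Fin (m + n)) _)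
      (_ : ∀ i j, τ (D' i j) = ((-1 : K) ^ (par m i + par m j)) • D' i j)
      (_ : ∀ i j, ρ (C i j) = superMulRight τ (par m i + par m j) (C' i j))
      (_ : ∀ i j, ρ (D i j) = superMulRight τ (par m i + par m j) (D' i j))
      (_ : D' * C' = 1) (i l : Fin (m + n)),
      ρ ((superTranspose m C * superTranspose m D) i l) =
        ρ ((1 : Matrix (Fin (m + n)) (Fin (m + n)) F) i l) := by
    intro C D C' D' hτ hC hD h i l
    have hj : ∀ j, ρ (superTranspose m C i j * superTranspose m D j l) =
        superMulRight τ (par m i + par m l)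
        (((-1 : K) ^ (par m i + par m i * par m l)) • (D' l j * C' j i)) := by
      intro j
      simp only [superTranspose, Matrix.of_apply, neg_one_pow_mul_smul (K := K), smul_mul_assoc,
        mul_smul_comm, smul_smul, map_smul, map_mul]
      rw [hC, hD, superMulRight_mul _ _ _ _ _ (hτ l j),
        show par m j + par m i + (par m l + par m j) =
          (par m i + par m l) + par m j + par m j + 0 by ring, hpar, add_zero, superMulRight_smul,
        smul_smul]
      congr 1
      rcases par_cases m i with hi | hi <;> rcases par_cases m j with hj | hj <;>
        rcases par_cases m l with hl | hl <;> norm_num [hi, hj, hl]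
    rw [Matrix.mul_apply, map_sum, Finset.sum_congr rfl fun j _ => hj j, ← superMulRight_sum,
      ← Finset.smul_sum, ← Matrix.mul_apply, h, map_one_apply, ← hone]
    congr 1
    by_cases hil : i = l
    · subst hil
      rw [Matrix.one_apply_eq]
      rcases par_cases m i with hi | hi <;> norm_num [hi]
    · rw [Matrix.one_apply_ne hil, Matrix.one_apply_ne (Ne.symm hil), smul_zero]
  cases h with
  | manin h => exact h.anti τ ρ hτA hA fun x y hxy => hR _ _ (.manin_inv hxy)
  | manin_inv h =>
    exact h.anti τ ρ hτB hB fun x y hxy => hR _ _ (.manin (by rwa [inv_inv] at hxy))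
  | mul_inv i j =>
    exact kmul A B A' B' hτB hA hB (Matrix.ext fun i j => hR _ _ (.st_mul_inv i j)) i j
  | inv_mul i j =>
    exact kmul B A B' A' hτA hB hA (Matrix.ext fun i j => hR _ _ (.st_inv_mul i j)) i j
  | st_inv_mul i j =>
    exact kst B A B' A' hτA hB hA (Matrix.ext fun i j => hR _ _ (.inv_mul i j)) i j
  | st_mul_inv i j =>
    exact kst A B A' B' hτB hA hB (Matrix.ext fun i j => hR _ _ (.mul_inv i j)) i j

/-- The Hopf relations are homogeneous: they survive the sign change by parity. -/
theorem HopfRel.parity {q : Kˣ} {m n : ℕ} {A B : Matrix (Fin (m + n)) (Fin (m + n)) F}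
    {A' B' : Matrix (Fin (m + n)) (Fin (m + n)) R} (f : F →ₐ[K] R)
    (hA : ∀ i j, f (A i j) = ((-1 : K) ^ (par m i + par m j)) • A' i j)
    (hB : ∀ i j, f (B i j) = ((-1 : K) ^ (par m i + par m j)) • B' i j)
    (hR : ∀ x y : R, HopfRel q m n A' B' x y → x = y) {x y : F} (h : HopfRel q m n A B x y) :
    f x = f y := by
  have key : ∀ (C D C' D' : Matrix (Fin (m + n)) (Fin (m + n)) _)
      (_ : ∀ i j, f (C i j) = ((-1 : K) ^ (par m i + par m j)) • C' i j)
      (_ : ∀ i j, f (D i j) = ((-1 : K) ^ (par m i + par m j)) • D' i j) (i j k l),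
      f (C i j * D k l) =
        ((-1 : K) ^ (par m i + par m j + par m k + par m l)) • (C' i j * D' k l) := by
    intro C D C' D' hC hD i j k l
    rw [map_mul, hC, hD, smul_mul_smul_comm, ← pow_add, ← add_assoc]
  have kmanin : ∀ (q : Kˣ) (C C' : Matrix (Fin (m + n)) (Fin (m + n)) _)
      (_ : ∀ i j, f (C i j) = ((-1 : K) ^ (par m i + par m j)) • C' i j)
      (_ : ∀ x y : R, ManinRel q m n C' x y → x = y) {x y} (_ : ManinRel q m n C x y),
      f x = f y := by
    intro q C C' hC hR x y h
    cases h with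
    | sq i j hi hj =>
      rw [key C C C' C' hC hC, hR _ _ (.sq i j hi hj), smul_zero, map_zero]
    | row i k l hi =>
      have h := hR _ _ (.row i k l hi)
      simp only [map_sub, map_smul, key C C C' C' hC hC, map_zero]
      rw [show par m i + par m l + par m i + par m k = par m i + par m k + par m i + par m l by
        ring, smul_comm, ← smul_sub, h, smul_zero]
    | col i j k hk =>
      have h := hR _ _ (.col i j k hk)
      simp only [map_sub, map_smul, key C C C' C' hC hC, map_zero]
      rw [show par m j + par m k + par m i + par m k = par m i + par m k + par m j + par m k by
        ring, smul_comm, ← smul_sub, h, smul_zero]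
    | cross i j k l =>
      have h := hR _ _ (.cross i j k l)
      simp only [map_sub, map_smul, key C C C' C' hC hC]
      rw [show par m k + par m l + par m i + par m j = par m i + par m j + par m k + par m l by
          ring,
        show par m k + par m j + par m i + par m l = par m i + par m j + par m k + par m l by ring,
        show par m i + par m l + par m k + par m j = par m i + par m j + par m k + par m l by ring,
        smul_comm, ← smul_sub, h, smul_sub, smul_comm, smul_comm (qs q (eps l j) _)]
  have kprod : ∀ (C D C' D' : Matrix (Fin (m + n)) (Fin (m + n)) _)
      (_ : ∀ i j, f (C i j) = ((-1 : K) ^ (par m i + par m j)) • C' i j)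
      (_ : ∀ i j, f (D i j) = ((-1 : K) ^ (par m i + par m j)) • D' i j)
      (_ : C' * D' = 1) (i l), f ((C * D) i l) =
        f ((1 : Matrix (Fin (m + n)) (Fin (m + n)) F) i l) := by
    intro C D C' D' hC hD h i l
    have hj : ∀ j, f (C i j * D j l) = ((-1 : K) ^ (par m i + par m l)) • (C' i j * D' j l) := by
      intro j
      rw [key C D C' D' hC hD]
      rcases par_cases m j with hj | hj <;> simp [hj, pow_succ, pow_add]
    rw [Matrix.mul_apply, map_sum, Finset.sum_congr rfl fun j _ => hj j, ← Finset.smul_sum,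
      ← Matrix.mul_apply, h, map_one_apply]
    by_cases hil : i = l
    · subst hil
      rw [Matrix.one_apply_eq, pow_add, sign_mul_self, one_smul]
    · rw [Matrix.one_apply_ne hil, smul_zero]
  have hst : ∀ (C C' : Matrix (Fin (m + n)) (Fin (m + n)) _)
      (_ : ∀ i j, f (C i j) = ((-1 : K) ^ (par m i + par m j)) • C' i j) (i j),
      f (superTranspose m C i j) =
        ((-1 : K) ^ (par m i + par m j)) • superTranspose m C' i j := by
    intro C C' hC i j
    simp only [superTranspose, Matrix.of_apply, neg_one_pow_mul_smul (K := K), map_smul, hC]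
    rw [smul_comm, add_comm (par m j)]
  cases h with
  | manin h => exact kmanin q A A' hA (fun x y hxy => hR _ _ (.manin hxy)) h
  | manin_inv h => exact kmanin q⁻¹ B B' hB (fun x y hxy => hR _ _ (.manin_inv hxy)) h
  | mul_inv i j => exact kprod A B A' B' hA hB (Matrix.ext fun i j => hR _ _ (.mul_inv i j)) i j
  | inv_mul i j => exact kprod B A B' A' hB hA (Matrix.ext fun i j => hR _ _ (.inv_mul i j)) i j
  | st_inv_mul i j =>
    exact kprod _ _ _ _ (hst B B' hB) (hst A A' hA)
      (Matrix.ext fun i j => hR _ _ (.st_inv_mul i j)) i j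
  | st_mul_inv i j =>
    exact kprod _ _ _ _ (hst A A' hA) (hst B B' hB)
      (Matrix.ext fun i j => hR _ _ (.st_mul_inv i j)) i j

/-- If a homomorphism identifies the two sides of each Hopf relation of `A, B`, then the images of
`A, B` satisfy the Hopf relations. -/
theorem HopfRel.image {q : Kˣ} {m n : ℕ} {A B : Matrix (Fin (m + n)) (Fin (m + n)) F}
    (f : F →ₐ[K] R) (hf : ∀ x y : F, HopfRel q m n A B x y → f x = f y) (x y : R)
    (h : HopfRel q m n (A.map f) (B.map f) x y) : x = y := by
  have hM : ∀ (q : Kˣ) (C : Matrix (Fin (m + n)) (Fin (m + n)) F)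
      (_ : ∀ x y : F, ManinRel q m n C x y → f x = f y) (x y : R)
      (_ : ManinRel q m n (C.map f) x y), x = y := by
    intro q C hC x y h
    cases h with
    | sq i j hi hj => simpa using hC _ _ (.sq i j hi hj)
    | row i k l hi => simpa using hC _ _ (.row i k l hi)
    | col i j k hk => simpa using hC _ _ (.col i j k hk)
    | cross i j k l => simpa using hC _ _ (.cross i j k l)
  cases h with
  | manin h => exact hM q A (fun _ _ h => hf _ _ (.manin h)) x y h
  | manin_inv h => exact hM q⁻¹ B (fun _ _ h => hf _ _ (.manin_inv h)) x y h
  | mul_inv i j =>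
    rw [← map_one_apply f, ← hf _ _ (.mul_inv i j)]; simp [Matrix.mul_apply]
  | inv_mul i j =>
    rw [← map_one_apply f, ← hf _ _ (.inv_mul i j)]; simp [Matrix.mul_apply]
  | st_inv_mul i j =>
    rw [← map_one_apply f, ← hf _ _ (.st_inv_mul i j)]
    simp [Matrix.mul_apply, superTranspose]
  | st_mul_inv i j =>
    rw [← map_one_apply f, ← hf _ _ (.st_mul_inv i j)]
    simp [Matrix.mul_apply, superTranspose]

end Descent

section Envelope

variable {K : Type*} [Field K]

/-- The generator matrices of a free algebra: `false` for the matrix `M`, `true` for its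
antipode matrix. -/
def freeGen (K : Type*) [Field K] (N : ℕ) (s : Bool) :
    Matrix (Fin N) (Fin N) (FreeAlgebra K (Bool × Fin N × Fin N)) :=
  Matrix.of fun i j => FreeAlgebra.ι K (s, i, j)

/-- The Hopf superalgebra of the `q`-super Manin matrix of type `m|n`, with an antipode of square
one. It is generated by the entries of the matrices `M̄₀ = M̄₂ = ⋯` (namely `M`) and
`M̄₁ = M̄₃ = ⋯` (namely `M⁻¹`). -/
abbrev HopfEnv (q : Kˣ) (m n : ℕ) : Type _ :=
  RingQuot (HopfRel q m n (freeGen K (m + n) false) (freeGen K (m + n) true))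

/-- The matrix `M` (for `false`) and the matrix `M⁻¹` (for `true`) over `HopfEnv q m n`. -/
def gen (q : Kˣ) (m n : ℕ) (s : Bool) : Matrix (Fin (m + n)) (Fin (m + n)) (HopfEnv q m n) :=
  (freeGen K (m + n) s).map
    (RingQuot.mkAlgHom K (HopfRel q m n (freeGen K (m + n) false) (freeGen K (m + n) true)))

theorem gen_rel (q : Kˣ) (m n : ℕ) (x y : HopfEnv q m n)
    (h : HopfRel q m n (gen q m n false) (gen q m n true) x y) : x = y :=
  HopfRel.image _ (fun _ _ h => RingQuot.mkAlgHom_rel K h) x y h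

/-- The homomorphism out of `HopfEnv q m n` given by `M ↦ A`, `M⁻¹ ↦ B`. -/
def HopfEnv.lift {q : Kˣ} {m n : ℕ} {R : Type*} [Ring R] [Algebra K R]
    (A B : Matrix (Fin (m + n)) (Fin (m + n)) R)
    (h : ∀ x y : R, HopfRel q m n A B x y → x = y) : HopfEnv q m n →ₐ[K] R :=
  RingQuot.liftAlgHom K
    ⟨FreeAlgebra.lift K fun u : Bool × Fin (m + n) × Fin (m + n) =>
        (if u.1 then B else A) u.2.1 u.2.2,
      fun _ _ hxy => h _ _ (hxy.map _ (by simp [freeGen]) (by simp [freeGen]))⟩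

/-- The parity automorphism of `HopfEnv q m n`: it multiplies `M_{ij}` and `(M⁻¹)_{ij}` by
`(-1)^{i+j}`. -/
def parityAut (q : Kˣ) (m n : ℕ) : HopfEnv q m n →ₐ[K] HopfEnv q m n :=
  RingQuot.liftAlgHom K
    ⟨FreeAlgebra.lift K fun u : Bool × Fin (m + n) × Fin (m + n) =>
        ((-1 : K) ^ (par m u.2.1 + par m u.2.2)) • gen q m n u.1 u.2.1 u.2.2,
      fun _ _ hxy => hxy.parity _ (by simp [freeGen]) (by simp [freeGen]) (gen_rel q m n)⟩

theorem parityAut_gen (q : Kˣ) (m n : ℕ) (s : Bool) (i j : Fin (m + n)) :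
    parityAut q m n (gen q m n s i j) =
      ((-1 : K) ^ (par m i + par m j)) • gen q m n s i j := by
  conv_lhs => rw [gen, Matrix.map_apply, parityAut, RingQuot.liftAlgHom_mkAlgHom_apply]
  simp [freeGen]

theorem parityAut_sq (q : Kˣ) (m n : ℕ) : parityAut q m n ^ 2 = 1 := by
  apply RingQuot.ringQuot_ext'
  apply FreeAlgebra.hom_ext
  funext ⟨s, i, j⟩
  change (parityAut q m n ^ 2) (gen q m n s i j) = gen q m n s i j
  rw [pow_two, AlgHom.mul_apply, parityAut_gen, map_smul, parityAut_gen, smul_smul, sign_mul_self,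
    one_smul]

/-- The super antihomomorphism `ω` in operator form: `u ↦ (x ↦ (-1)^{|u||x|} x * ω(u))`. -/
def omegaOp (q : Kˣ) (m n : ℕ) : HopfEnv q m n →ₐ[K] Module.End K (HopfEnv q m n) :=
  RingQuot.liftAlgHom K
    ⟨FreeAlgebra.lift K fun u : Bool × Fin (m + n) × Fin (m + n) =>
        superMulRight (parityAut q m n) (par m u.2.1 + par m u.2.2) (gen q m n (!u.1) u.2.1 u.2.2),
      fun _ _ hxy => hxy.anti (parityAut q m n) (parityAut_sq q m n) _
        (A' := gen q m n true) (B' := gen q m n false)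
        (parityAut_gen q m n true) (parityAut_gen q m n false)
        (by simp [freeGen]) (by simp [freeGen]) (gen_rel q m n)⟩

/-- The anti-isomorphism `ω` of the superalgebra `HopfEnv q m n` (its antipode): the linear map with
`ω(M) = M⁻¹`, `ω(M⁻¹) = M`, `ω(1) = 1` and `ω(u v) = (-1)^{|u||v|} ω(v) ω(u)`. -/
def omega (q : Kˣ) (m n : ℕ) : HopfEnv q m n →ₗ[K] HopfEnv q m n :=
  LinearMap.applyₗ (1 : HopfEnv q m n) ∘ₗ (omegaOp q m n).toLinearMap

theorem omegaOp_gen (q : Kˣ) (m n : ℕ) (s : Bool) (i j : Fin (m + n)) :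
    omegaOp q m n (gen q m n s i j) =
      superMulRight (parityAut q m n) (par m i + par m j) (gen q m n (!s) i j) := by
  conv_lhs => rw [gen, Matrix.map_apply, omegaOp, RingQuot.liftAlgHom_mkAlgHom_apply]
  simp [freeGen]

theorem omega_one (q : Kˣ) (m n : ℕ) : omega q m n 1 = 1 := by
  simp [omega]

theorem omega_gen (q : Kˣ) (m n : ℕ) (s : Bool) (i j : Fin (m + n)) :
    omega q m n (gen q m n s i j) = gen q m n (!s) i j := by
  simp [omega, omegaOp_gen, superMulRight_apply]

/-- The super antihomomorphism rule for a generator `u` and an arbitrary `x`; the power of the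
parity automorphism is the sign `(-1)^{|u||x|}`. -/
theorem omega_gen_mul (q : Kˣ) (m n : ℕ) (s : Bool) (i j : Fin (m + n)) (x : HopfEnv q m n) :
    omega q m n (gen q m n s i j * x) =
      (parityAut q m n ^ (par m i + par m j)) (omega q m n x) * gen q m n (!s) i j := by
  simp [omega, omegaOp_gen, superMulRight_apply]

/-- The quantum Berezinian of the generator matrix, in `HopfEnv q m n`. -/
def Ber (q : Kˣ) (m n : ℕ) : HopfEnv q m n :=
  qBer q m n (gen q m n false) (gen q m n true)

end Envelope

section Localization

variable {K : Type*} [Field K]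

/-- The index `k + i` of the large matrix. -/
def shift (k : ℕ) {m n : ℕ} (i : Fin (m + n)) : Fin (k + m + n) :=
  (Fin.natAdd k i).cast (Nat.add_assoc k m n).symm

theorem par_shift (k : ℕ) {m n : ℕ} (i : Fin (m + n)) : par (k + m) (shift k i) = par m i := by
  simp [par, shift]

/-- The index `i ≤ k` of the large matrix. -/
def lead {k : ℕ} (m n : ℕ) (i : Fin k) : Fin (k + m + n) := Fin.castAdd n (Fin.castAdd m i)

/-- The indices `1, …, k, k + i`. -/
def border {k m n : ℕ} (i : Fin (m + n)) : Fin (k + 1) → Fin (k + m + n) :=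
  Fin.lastCases (shift k i) (lead m n)

/-- Generators of the localization below: entries of a pair of large matrices and of a pair of
small matrices. -/
abbrev LocGen (k m n : ℕ) : Type :=
  (Bool × Fin (k + m + n) × Fin (k + m + n)) ⊕ (Bool × Fin (m + n) × Fin (m + n))

/-- The generator matrices `M` (for `false`) and `M⁻¹` (for `true`) of size `k + m + n`. -/
def freeBig (K : Type*) [Field K] (k m n : ℕ) (s : Bool) :
    Matrix (Fin (k + m + n)) (Fin (k + m + n)) (FreeAlgebra K (LocGen k m n)) :=
  Matrix.of fun i j => FreeAlgebra.ι K (Sum.inl (s, i, j))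

/-- The generator matrices of size `m + n`: the inverse of the lower right block of `M`
(for `false`) and the inverse of the lower right block of `M⁻¹` (for `true`). -/
def freeSmall (K : Type*) [Field K] (k m n : ℕ) (s : Bool) :
    Matrix (Fin (m + n)) (Fin (m + n)) (FreeAlgebra K (LocGen k m n)) :=
  Matrix.of fun i j => FreeAlgebra.ι K (Sum.inr (s, i, j))

/-- Relations of the localization, see `Loc`. -/
inductive LocRel (q : Kˣ) (k m n : ℕ) :
    FreeAlgebra K (LocGen k m n) → FreeAlgebra K (LocGen k m n) → Prop
  | big {x y : FreeAlgebra K (LocGen k m n)}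
      (h : HopfRel q (k + m) n (freeBig K k m n false) (freeBig K k m n true) x y) :
      LocRel q k m n x y
  | block {x y : FreeAlgebra K (LocGen k m n)}
      (h : HopfRel q m n ((freeBig K k m n false).submatrix (shift k) (shift k))
        (freeSmall K k m n false) x y) : LocRel q k m n x y
  | dual {x y : FreeAlgebra K (LocGen k m n)}
      (h : HopfRel q m n (freeSmall K k m n true)
        ((freeBig K k m n true).submatrix (shift k) (shift k)) x y) : LocRel q k m n x y

/-- The localization of `HopfEnv q (k + m) n` in which `ω ∘ φ_k ∘ ω` takes its values. The
homomorphism `φ_k : M_{ij} ↦ M_{k+i,k+j}` is defined on `HopfEnv q m n` only if the lower right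
`(m+n) × (m+n)` block `X` of `M` has an inverse `Y` for which `(X, Y)` satisfies the relations of
`(M, M⁻¹)` in `HopfEnv q m n`. `Loc q k m n` is the universal superalgebra over
`HopfEnv q (k + m) n` which contains such a `Y` (relations `block`) and to which `ω` extends, with
`ω ∘ ω = id`. By
the latter it also contains the entries of `Z = ω(Y)`, and applying `ω` to the relations of `(X, Y)`
shows that `(Z, W)` satisfies the relations of `HopfEnv q m n`, where `W` is the lower right block
of `M⁻¹` (relations `dual`). -/
abbrev Loc (q : Kˣ) (k m n : ℕ) : Type _ := RingQuot (LocRel q k m n)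

/-- `M` (for `false`) and `M⁻¹` (for `true`) over `Loc q k m n`. -/
def big (q : Kˣ) (k m n : ℕ) (s : Bool) :
    Matrix (Fin (k + m + n)) (Fin (k + m + n)) (Loc q k m n) :=
  (freeBig K k m n s).map (RingQuot.mkAlgHom K (LocRel q k m n))

/-- The inverses of the lower right blocks of `M` (for `false`) and of `M⁻¹` (for `true`) over
`Loc q k m n`. -/
def small (q : Kˣ) (k m n : ℕ) (s : Bool) : Matrix (Fin (m + n)) (Fin (m + n)) (Loc q k m n) :=
  (freeSmall K k m n s).map (RingQuot.mkAlgHom K (LocRel q k m n))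

theorem big_rel (q : Kˣ) (k m n : ℕ) (x y : Loc q k m n)
    (h : HopfRel q (k + m) n (big q k m n false) (big q k m n true) x y) : x = y :=
  HopfRel.image _ (fun _ _ h => RingQuot.mkAlgHom_rel K (.big h)) x y h

theorem block_rel (q : Kˣ) (k m n : ℕ) (x y : Loc q k m n)
    (h : HopfRel q m n ((big q k m n false).submatrix (shift k) (shift k)) (small q k m n false)
      x y) : x = y :=
  HopfRel.image (RingQuot.mkAlgHom K (LocRel q k m n))
    (fun _ _ h => RingQuot.mkAlgHom_rel K (.block h)) x y h

theorem dual_rel (q : Kˣ) (k m n : ℕ) (x y : Loc q k m n)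
    (h : HopfRel q m n (small q k m n true) ((big q k m n true).submatrix (shift k) (shift k))
      x y) : x = y :=
  HopfRel.image (RingQuot.mkAlgHom K (LocRel q k m n))
    (fun _ _ h => RingQuot.mkAlgHom_rel K (.dual h)) x y h

/-- The canonical homomorphism from `HopfEnv q (k + m) n` to its localization. -/
def toLoc (q : Kˣ) (k m n : ℕ) : HopfEnv q (k + m) n →ₐ[K] Loc q k m n :=
  HopfEnv.lift (big q k m n false) (big q k m n true) (big_rel q k m n)

/-- The homomorphism `φ_k : M_{ij} ↦ M_{k+i,k+j}`. -/
def phi (q : Kˣ) (k m n : ℕ) : HopfEnv q m n →ₐ[K] Loc q k m n :=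
  HopfEnv.lift ((big q k m n false).submatrix (shift k) (shift k)) (small q k m n false)
    (block_rel q k m n)

/-- The parity of a generator (as a natural number, to be read modulo two). -/
def locPar {k m n : ℕ} : LocGen k m n → ℕ
  | .inl (_, i, j) => par (k + m) i + par (k + m) j
  | .inr (_, i, j) => par m i + par m j

/-- The images of the generators in `Loc q k m n`. -/
def locGen (q : Kˣ) (k m n : ℕ) : LocGen k m n → Loc q k m n
  | .inl (s, i, j) => big q k m n s i j
  | .inr (s, i, j) => small q k m n s i j

/-- The action of `ω` on generators. -/
def locSwap {k m n : ℕ} : LocGen k m n → LocGen k m n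
  | .inl (s, i, j) => .inl (!s, i, j)
  | .inr (s, i, j) => .inr (!s, i, j)

/-- The parity automorphism of `Loc q k m n`. -/
def locParityAut (q : Kˣ) (k m n : ℕ) : Loc q k m n →ₐ[K] Loc q k m n :=
  RingQuot.liftAlgHom K
    ⟨FreeAlgebra.lift K fun u : LocGen k m n => ((-1 : K) ^ locPar u) • locGen q k m n u, by
      intro x y hxy
      cases hxy with
      | big h =>
        exact h.parity _ (by simp [freeBig, locPar, locGen]) (by simp [freeBig, locPar, locGen])
          (big_rel q k m n)
      | block h =>
        exact h.parity _ (by simp [freeBig, locPar, locGen, par_shift])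
          (by simp [freeSmall, locPar, locGen]) (block_rel q k m n)
      | dual h =>
        exact h.parity _ (by simp [freeSmall, locPar, locGen])
          (by simp [freeBig, locPar, locGen, par_shift]) (dual_rel q k m n)⟩

theorem locParityAut_gen (q : Kˣ) (k m n : ℕ) (u : LocGen k m n) :
    locParityAut q k m n (locGen q k m n u) = ((-1 : K) ^ locPar u) • locGen q k m n u := by
  have h : locGen q k m n u = RingQuot.mkAlgHom K (LocRel q k m n) (FreeAlgebra.ι K u) := by
    rcases u with ⟨s, i, j⟩ | ⟨s, i, j⟩ <;> rfl
  conv_lhs => rw [h, locParityAut, RingQuot.liftAlgHom_mkAlgHom_apply]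
  simp

theorem locParityAut_sq (q : Kˣ) (k m n : ℕ) : locParityAut q k m n ^ 2 = 1 := by
  apply RingQuot.ringQuot_ext'
  apply FreeAlgebra.hom_ext
  funext u
  have h : locGen q k m n u = RingQuot.mkAlgHom K (LocRel q k m n) (FreeAlgebra.ι K u) := by
    rcases u with ⟨s, i, j⟩ | ⟨s, i, j⟩ <;> rfl
  change (locParityAut q k m n ^ 2) (RingQuot.mkAlgHom K (LocRel q k m n) (FreeAlgebra.ι K u)) =
    RingQuot.mkAlgHom K (LocRel q k m n) (FreeAlgebra.ι K u)
  rw [← h, pow_two, AlgHom.mul_apply, locParityAut_gen, map_smul, locParityAut_gen, smul_smul,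
    sign_mul_self, one_smul]

/-- The extension of `ω` to `Loc q k m n` in operator form:
`u ↦ (x ↦ (-1)^{|u||x|} x * ω(u))`. -/
def locOmegaOp (q : Kˣ) (k m n : ℕ) : Loc q k m n →ₐ[K] Module.End K (Loc q k m n) :=
  RingQuot.liftAlgHom K
    ⟨FreeAlgebra.lift K fun u : LocGen k m n =>
        superMulRight (locParityAut q k m n) (locPar u) (locGen q k m n (locSwap u)), by
      have hb : ∀ s i j, locParityAut q k m n (big q k m n s i j) = _ :=
        fun s i j => locParityAut_gen q k m n (.inl (s, i, j))
      have hs : ∀ s i j, locParityAut q k m n (small q k m n s i j) = _ :=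
        fun s i j => locParityAut_gen q k m n (.inr (s, i, j))
      simp only [locPar, locGen] at hb hs
      intro x y hxy
      cases hxy with
      | big h =>
        exact h.anti (locParityAut q k m n) (locParityAut_sq q k m n) _
          (A' := big q k m n true) (B' := big q k m n false) (hb true) (hb false)
          (by simp [freeBig, locPar, locGen, locSwap]) (by simp [freeBig, locPar, locGen, locSwap])
          (big_rel q k m n)
      | block h =>
        exact h.anti (locParityAut q k m n) (locParityAut_sq q k m n) _
          (A' := (big q k m n true).submatrix (shift k) (shift k)) (B' := small q k m n true)
          (by simp [hb, par_shift]) (hs true)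
          (by simp [freeBig, locPar, locGen, locSwap, par_shift])
          (by simp [freeSmall, locPar, locGen, locSwap]) (dual_rel q k m n)
      | dual h =>
        exact h.anti (locParityAut q k m n) (locParityAut_sq q k m n) _
          (A' := small q k m n false) (B' := (big q k m n false).submatrix (shift k) (shift k))
          (hs false) (by simp [hb, par_shift])
          (by simp [freeSmall, locPar, locGen, locSwap])
          (by simp [freeBig, locPar, locGen, locSwap, par_shift]) (block_rel q k m n)⟩

/-- The extension of `ω` to `Loc q k m n`: the linear map with `ω(M) = M⁻¹`, `ω(M⁻¹) = M`,
exchanging the inverses of the lower right blocks of `M` and `M⁻¹`, with `ω(1) = 1` and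
`ω(u v) = (-1)^{|u||v|} ω(v) ω(u)`. -/
def locOmega (q : Kˣ) (k m n : ℕ) : Loc q k m n →ₗ[K] Loc q k m n :=
  LinearMap.applyₗ (1 : Loc q k m n) ∘ₗ (locOmegaOp q k m n).toLinearMap

theorem locOmegaOp_gen (q : Kˣ) (k m n : ℕ) (u : LocGen k m n) :
    locOmegaOp q k m n (locGen q k m n u) =
      superMulRight (locParityAut q k m n) (locPar u) (locGen q k m n (locSwap u)) := by
  have h : locGen q k m n u = RingQuot.mkAlgHom K (LocRel q k m n) (FreeAlgebra.ι K u) := by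
    rcases u with ⟨s, i, j⟩ | ⟨s, i, j⟩ <;> rfl
  conv_lhs => rw [h, locOmegaOp, RingQuot.liftAlgHom_mkAlgHom_apply]
  simp

theorem locOmega_gen_mul (q : Kˣ) (k m n : ℕ) (u : LocGen k m n) (x : Loc q k m n) :
    locOmega q k m n (locGen q k m n u * x) =
      (locParityAut q k m n ^ locPar u) (locOmega q k m n x) *
        locGen q k m n (locSwap u) := by
  simp [locOmega, locOmegaOp_gen, superMulRight_apply]

/-- The map `ψ_k = ω ∘ φ_k ∘ ω`. -/
def psi (q : Kˣ) (k m n : ℕ) : HopfEnv q m n →ₗ[K] Loc q k m n :=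
  locOmega q k m n ∘ₗ (phi q k m n).toLinearMap ∘ₗ omega q m n

end Localization

end SuperManin

end

/-!
# Quantum Berezinians of quasideterminants

Write `A` for the leading `k × k` block of `M`, and let `W`, `Z` be the lower right block of `M⁻¹`
and its inverse. Since `ω` exchanges the inverses of the two lower right blocks, `ψ_k` maps `M` to
`Z` and `M⁻¹` to `W`. Noncommutative block inversion (`block_inverse`) shows that `A` is invertible
because `W` is, and that `Z` is the Schur complement of `A` in `M`; this is the quasideterminant
formula.

`ψ_k` is multiplicative on products of even generators (`psi_gen_mul`), so it maps the Berezinian to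
`det_q Z₀ * detRow W₁`, where `Z₀` is the even block of `Z` and `W₁` is the odd block of `W`, hence
also of `M⁻¹`. The factor `detRow W₁` is common to both sides, and what remains is Schur's formula
`det_q E = det_q A * det_q Z₀` for the even block `E` of `M` (`IsQManin.qDet_schur`). It is proved
with Grassmann variables: by the Manin relations the forms `y_j = ∑ i, x_i E_{ij}` satisfy the same
relations as the `x_i`, and `y_1 ⋯ y_r = x_1 ⋯ x_r det_q E`. In `y_1 ⋯ y_{k+m}` the last `m` factors
may be changed by combinations of the first `k` so as to become the forms of `Z₀` in
`x_{k+1}, …, x_{k+m}`; then only the part of `y_1 ⋯ y_k` in `x_1, …, x_k` survives.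

A right inverse of `det_q A` is obtained by expressing the `x_i` by the `y_j`
(`IsQManin.exists_qDet_mul_eq_one`). The same argument gives a right inverse of `det_{q⁻¹}` of the
leading block of `M⁻¹`, and the antipode `ω` turns it into a left inverse of `det_q A`
(`IsQManin.qDet_op`, `isUnit_qDet_lead`).
-/

namespace SuperManin

open Finset

/-! ### Products of `q`-anticommuting elements -/

section Sorting

variable {K G ι : Type*} [Field K] [Ring G] [Algebra K G] [LinearOrder ι]

/-- A family of elements satisfying the relations of the `q`-Grassmann algebra: `y_a ^ 2 = 0` and
`y_b y_a = -q⁻¹ y_a y_b` for `a < b`. -/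
structure QAnticommute (q : Kˣ) (y : ι → G) : Prop where
  sq (a : ι) : y a * y a = 0
  swap (a b : ι) (h : a < b) : y b * y a = (-(↑q⁻¹ : K)) • (y a * y b)

/-- The number of inversions of a list. -/
def listInv : List ι → ℕ
  | [] => 0
  | a :: l => l.countP (fun b => decide (b < a)) + listInv l

namespace QAnticommute

variable {q : Kˣ} {y : ι → G}

theorem comp_strictMono {κ : Type*} [LinearOrder κ] (hy : QAnticommute q y) {f : κ → ι}
    (hf : StrictMono f) : QAnticommute q (y ∘ f) :=
  ⟨fun a => hy.sq (f a), fun _ _ h => hy.swap _ _ (hf h)⟩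

theorem op (hy : QAnticommute q y) : QAnticommute q⁻¹ fun a => MulOpposite.op (y a) := by
  refine ⟨fun a => by rw [← MulOpposite.op_mul, hy.sq, MulOpposite.op_zero], fun a b h => ?_⟩
  rw [← MulOpposite.op_mul, ← MulOpposite.op_mul, hy.swap a b h, MulOpposite.op_smul, smul_smul]
  simp

/-- Elements may be commuted up to a unit until the repeated factor meets its copy. -/
theorem mul_prod_eq_zero (hy : QAnticommute q y) {a : ι} {l : List ι} (h : a ∈ l) :
    y a * (l.map y).prod = 0 := by
  induction l with
  | nil => simp at h
  | cons b l ih =>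
    rw [List.map_cons, List.prod_cons, ← mul_assoc]
    rcases List.mem_cons.1 h with rfl | h
    · rw [hy.sq, zero_mul]
    · rcases lt_trichotomy a b with hab | rfl | hab
      · have := hy.swap a b hab
        have h2 : y a * y b = (-(q : K)) • (y b * y a) := by rw [this, smul_smul]; simp
        rw [h2, smul_mul_assoc, mul_assoc, ih h, mul_zero, smul_zero]
      · rw [hy.sq, zero_mul]
      · rw [hy.swap b a hab, smul_mul_assoc, mul_assoc, ih h, mul_zero, smul_zero]

theorem prod_eq_zero (hy : QAnticommute q y) {l : List ι} (h : ¬ l.Nodup) :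
    (l.map y).prod = 0 := by
  induction l with
  | nil => simp at h
  | cons a l ih =>
    rw [List.map_cons, List.prod_cons]
    by_cases ha : a ∈ l
    · exact hy.mul_prod_eq_zero ha
    · rw [ih fun hl => h (List.nodup_cons.2 ⟨ha, hl⟩), mul_zero]

theorem mul_prod_sorted (hy : QAnticommute q y) (a : ι) {l : List ι} (hl : l.Pairwise (· ≤ ·)) :
    y a * (l.map y).prod = (-(↑q⁻¹ : K)) ^ l.countP (fun b => decide (b < a)) •
      ((l.orderedInsert (· ≤ ·) a).map y).prod := by
  induction l with
  | nil => simp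
  | cons b l ih =>
    rw [List.pairwise_cons] at hl
    by_cases h : a ≤ b
    · have h0 : (b :: l).countP (fun c => decide (c < a)) = 0 := by
        rw [List.countP_eq_zero]
        intro c hc
        rcases List.mem_cons.1 hc with rfl | hc
        · simpa using h
        · simpa using h.trans (hl.1 c hc)
      rw [h0, List.orderedInsert_cons_of_le _ _ h, pow_zero, one_smul, List.map_cons,
        List.map_cons, List.map_cons, List.prod_cons, List.prod_cons, List.prod_cons]
    · rw [List.orderedInsert_of_not_le _ _ h, List.map_cons, List.map_cons, List.prod_cons,
        List.prod_cons, ← mul_assoc, hy.swap b a (not_le.1 h), smul_mul_assoc, mul_assoc, ih hl.2,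
        mul_smul_comm, smul_smul, List.countP_cons_of_pos (by simpa using h), pow_succ']

/-- Sorting a product of `q`-anticommuting elements multiplies it by `-q⁻¹` for each inversion. -/
theorem prod_eq_sorted (hy : QAnticommute q y) (l : List ι) :
    (l.map y).prod =
      (-(↑q⁻¹ : K)) ^ listInv l • ((l.insertionSort (· ≤ ·)).map y).prod := by
  induction l with
  | nil => simp [listInv]
  | cons a l ih =>
    rw [List.map_cons, List.prod_cons, ih, mul_smul_comm,
      hy.mul_prod_sorted a (List.pairwise_insertionSort _ l), smul_smul,
      (List.perm_insertionSort (· ≤ ·) l).countP_eq, ← pow_add, listInv, add_comm]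
    rfl

end QAnticommute

theorem listInv_ofFn {r : ℕ} (f : Fin r → ι) : listInv (List.ofFn f) =
    (univ.filter fun p : Fin r × Fin r => p.1 < p.2 ∧ f p.2 < f p.1).card := by
  induction r with
  | zero => simp [listInv]
  | succ r ih =>
    rw [List.ofFn_succ, listInv, ih, Finset.card_filter, Finset.card_filter,
      Fintype.sum_prod_type, Fintype.sum_prod_type, Fin.sum_univ_succ]
    congr 1
    · rw [Fin.sum_univ_succ]
      simp only [lt_self_iff_false, false_and, if_false, Fin.succ_pos, true_and, zero_add]
      rw [List.ofFn_eq_map, List.countP_map, ← Finset.card_filter]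
      rw [Finset.card_def, Finset.filter_val, ← Multiset.countP_eq_card_filter]
      rfl
    · refine Finset.sum_congr rfl fun i _ => ?_
      rw [Fin.sum_univ_succ]
      simp

theorem insertionSort_ofFn_perm {r : ℕ} (σ : Equiv.Perm (Fin r)) :
    (List.ofFn σ).insertionSort (· ≤ ·) = List.ofFn id := by
  refine List.Perm.eq_of_pairwise (le := (· ≤ ·)) (fun a b _ _ => le_antisymm)
    (List.pairwise_insertionSort _ _) ?_
    ((List.perm_insertionSort _ _).trans (Equiv.Perm.ofFn_comp_perm σ id))
  rw [List.pairwise_ofFn]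
  exact fun i j h => h.le

variable {q : Kˣ} {r : ℕ}

theorem permCoeff_eq (σ : Equiv.Perm (Fin r)) :
    (permCoeff q σ : K) = (-(↑q⁻¹ : K)) ^ invLength σ := by
  rw [permCoeff, zpow_neg, zpow_natCast, ← inv_pow, Units.val_pow_eq_pow_val, inv_neg,
    Units.val_neg]

namespace QAnticommute

theorem prod_perm {y : Fin r → G} (hy : QAnticommute q y) (σ : Equiv.Perm (Fin r)) :
    (List.ofFn fun i => y (σ i)).prod = (permCoeff q σ : K) • (List.ofFn y).prod := by
  have h := hy.prod_eq_sorted (List.ofFn σ)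
  rw [insertionSort_ofFn_perm, List.map_ofFn, List.map_ofFn, listInv_ofFn] at h
  rw [permCoeff_eq]
  exact h

theorem prod_not_injective {y : ι → G} (hy : QAnticommute q y) {f : Fin r → ι}
    (hf : ¬ Function.Injective f) : (List.ofFn fun i => y (f i)).prod = 0 := by
  have h := hy.prod_eq_zero (l := List.ofFn f) (by rwa [List.nodup_ofFn])
  rwa [List.map_ofFn] at h

end QAnticommute

end Sorting

/-! ### The `q`-Grassmann algebra with coefficients -/

section Model

variable {K F ι : Type*} [Field K] [Ring F] [Algebra K F] [LinearOrder ι]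

/-- The operator of left multiplication by the generator `x_i` on the `q`-Grassmann algebra with
coefficients in `F`, in the basis of ordered monomials, which are indexed by finite sets. -/
def grassmannGen (F : Type*) [Ring F] [Algebra K F] (q : Kˣ) (i : ι) :
    Module.End K (Finset ι → F) where
  toFun φ S := if i ∈ S then (-(↑q⁻¹ : K)) ^ (S.filter (· < i)).card • φ (S.erase i) else 0
  map_add' φ ψ := by ext S; by_cases h : i ∈ S <;> simp [h]
  map_smul' c φ := by ext S; by_cases h : i ∈ S <;> simp [h, smul_comm c]

theorem grassmannGen_apply (q : Kˣ) (i : ι) (φ : Finset ι → F) (S : Finset ι) :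
    grassmannGen F q i φ S =
      if i ∈ S then (-(↑q⁻¹ : K)) ^ (S.filter (· < i)).card • φ (S.erase i) else 0 := rfl

theorem grassmannGen_qAnticommute (q : Kˣ) :
    QAnticommute q (grassmannGen F q : ι → Module.End K (Finset ι → F)) := by
  refine ⟨fun a => ?_, fun a b h => ?_⟩
  · ext φ S
    simp [grassmannGen_apply]
  · ext φ S
    simp only [Module.End.mul_apply, LinearMap.smul_apply, Pi.smul_apply, grassmannGen_apply,
      mem_erase, ne_eq, h.ne, h.ne', not_false_eq_true, true_and]
    by_cases ha : a ∈ S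
    · by_cases hb : b ∈ S
      · simp only [ha, hb, if_true, smul_smul]
        have h1 : (S.filter (· < b)).card = ((S.erase a).filter (· < b)).card + 1 := by
          rw [Finset.filter_erase, Finset.card_erase_add_one (by simp [ha, h])]
        have h2 : (S.erase b).filter (· < a) = S.filter (· < a) := by
          rw [Finset.filter_erase, Finset.erase_eq_of_notMem (by simp [h.le])]
        rw [h1, h2, Finset.erase_right_comm]
        congr 1
        ring
      · simp [ha, hb]
    · simp [ha]

/-- Left multiplication by coefficients from `F`, as operators on the `q`-Grassmann algebra. They
commute with the variables. -/
def grassmannCoeff (K F ι : Type*) [Field K] [Ring F] [Algebra K F] :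
    F →ₐ[K] Module.End K (Finset ι → F) :=
  Algebra.lsmul K K (Finset ι → F)

theorem grassmannGen_commute (q : Kˣ) (i : ι) (c : F) :
    Commute (grassmannGen F q i) (grassmannCoeff K F ι c) := by
  ext φ S
  by_cases h : i ∈ S <;> simp [grassmannGen_apply, grassmannCoeff, h]

/-- The product of distinct generators in increasing order, applied to the monomial `1` with
coefficient `c`, is the corresponding ordered monomial with the same coefficient. -/
theorem grassmannGen_prod_sorted (q : Kˣ) (c : F) {l : List ι} (hl : l.Pairwise (· < ·)) :
    (l.map (grassmannGen F q)).prod (Pi.single ∅ c) l.toFinset = c := by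
  induction l with
  | nil => simp
  | cons a l ih =>
    rw [List.pairwise_cons] at hl
    have ha : a ∉ l.toFinset := fun h => (hl.1 a (List.mem_toFinset.1 h)).false
    have h0 : (insert a l.toFinset).filter (· < a) = ∅ := by
      rw [Finset.filter_eq_empty_iff]
      intro b hb
      rcases Finset.mem_insert.1 hb with rfl | hb
      · exact lt_irrefl _
      · exact (hl.1 b (List.mem_toFinset.1 hb)).not_gt
    rw [List.map_cons, List.prod_cons, Module.End.mul_apply, grassmannGen_apply,
      List.toFinset_cons, if_pos (mem_insert_self _ _), h0, erase_insert ha, ih hl.2]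
    simp

/-- The product of all generators is part of a basis of the Grassmann algebra over `F`. -/
theorem grassmannGen_top_injective (q : Kˣ) (r : ℕ) {c d : F}
    (h : (List.ofFn (grassmannGen F q : Fin r → _)).prod * grassmannCoeff K F (Fin r) c =
      (List.ofFn (grassmannGen F q : Fin r → _)).prod * grassmannCoeff K F (Fin r) d) : c = d := by
  have key : ∀ e : F, ((List.ofFn (grassmannGen F q : Fin r → _)).prod *
      grassmannCoeff K F (Fin r) e) (Pi.single ∅ 1) (List.ofFn (id : Fin r → _)).toFinset = e := by
    intro e
    have hs : grassmannCoeff K F (Fin r) e (Pi.single ∅ 1) = Pi.single ∅ e := by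
      ext S
      by_cases hS : S = ∅
      · subst hS; simp [grassmannCoeff]
      · simp [grassmannCoeff, hS]
    rw [Module.End.mul_apply, hs]
    have h := grassmannGen_prod_sorted q e (l := List.ofFn (id : Fin r → _))
      (by rw [List.pairwise_ofFn]; exact fun i j h => h)
    rw [List.map_ofFn] at h
    exact h
  rw [← key c, h, key d]

end Model

/-! ### Quantum determinants of `q`-Manin matrices -/

section QManin

variable {K F G ι κ : Type*} [Field K] [Ring F] [Algebra K F] [Ring G] [Algebra K G]
  {x : ι → G} {c : F →ₐ[K] G}

/-- The linear forms `∑ i, x_i E_{ij}` in the Grassmann variables `x_i`, one for each column of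
`E`. -/
def columnForm [Fintype ι] (x : ι → G) (c : F →ₐ[K] G) (E : Matrix ι κ F) (j : κ) : G :=
  ∑ i, x i * c (E i j)

theorem columnForm_mul [Fintype ι] (hc : ∀ i f, Commute (x i) (c f)) (E : Matrix ι κ F)
    (a b : κ) : columnForm x c E a * columnForm x c E b =
      ∑ i, ∑ j, x i * x j * c (E i a * E j b) := by
  simp only [columnForm, sum_mul_sum]
  refine sum_congr rfl fun i _ => sum_congr rfl fun j _ => ?_
  rw [mul_assoc, ← mul_assoc (c _), ← (hc j _).eq, map_mul]
  simp only [mul_assoc]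

theorem prod_ofFn_mul {r : ℕ} (u v : Fin r → G) (h : ∀ i j, Commute (u i) (v j)) :
    (List.ofFn fun i => u i * v i).prod = (List.ofFn u).prod * (List.ofFn v).prod := by
  induction r with
  | zero => simp
  | succ r ih =>
    simp only [List.ofFn_succ, List.prod_cons]
    rw [ih _ _ fun i j => h _ _, mul_assoc, mul_assoc, ← mul_assoc (v 0), ← mul_assoc _ (v 0)]
    congr 2
    refine (Commute.list_prod_left _ _ ?_).eq.symm
    intro z hz
    obtain ⟨i, rfl⟩ := List.mem_ofFn.1 hz
    exact h _ _

/-- A product of column forms, expanded. The coefficients may be collected on the right because they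
commute with the variables. -/
theorem prod_columnForm_eq_sum [Fintype ι] {r : ℕ} (hc : ∀ i f, Commute (x i) (c f))
    (E : Matrix ι (Fin r) F) :
    (List.ofFn (columnForm x c E)).prod = ∑ f : Fin r → ι,
      (List.ofFn fun j => x (f j)).prod * c (List.ofFn fun j => E (f j) j).prod := by
  have h := (MultilinearMap.mkPiAlgebraFin K r G).map_sum fun j i => x i * c (E i j)
  simp only [MultilinearMap.mkPiAlgebraFin_apply] at h
  refine h.trans (sum_congr rfl fun f _ => ?_)
  rw [prod_ofFn_mul _ _ fun i j => hc _ _, map_list_prod, List.map_ofFn]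
  rfl

variable [LinearOrder ι] [LinearOrder κ]

/-- A (purely even) `q`-Manin matrix: entries in the same column `q`-commute, and the cross
commutation relations hold for `2 × 2` submatrices. -/
structure IsQManin (q : Kˣ) (E : Matrix ι κ F) : Prop where
  col (i j : ι) (a : κ) (h : i < j) : E i a * E j a = (↑q⁻¹ : K) • (E j a * E i a)
  cross (i j : ι) (a b : κ) (hij : i < j) (hab : a < b) :
    E i a * E j b - E j b * E i a = (↑q⁻¹ : K) • (E j a * E i b) - (q : K) • (E i b * E j a)

theorem IsQManin.submatrix {ι' κ' : Type*} [LinearOrder ι'] [LinearOrder κ'] {q : Kˣ}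
    {E : Matrix ι κ F} (hE : IsQManin q E) {f : ι' → ι} {g : κ' → κ} (hf : StrictMono f)
    (hg : StrictMono g) : IsQManin q (E.submatrix f g) :=
  ⟨fun _ _ _ h => hE.col _ _ _ (hf h), fun _ _ _ _ h h' => hE.cross _ _ _ _ (hf h) (hg h')⟩

variable {q : Kˣ}

/-- Collecting the coefficients of the monomials `x_i x_j` with `i < j` in a quadratic form. -/
theorem QAnticommute.sum_sum [Fintype ι] (hx : QAnticommute q x) (g : ι → ι → F) :
    ∑ i, ∑ j, x i * x j * c (g i j) =
      ∑ i, ∑ j, if i < j then x i * x j * c (g i j - (↑q⁻¹ : K) • g j i) else 0 := by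
  have h : ∀ i j, x i * x j * c (g i j) = (if i < j then x i * x j * c (g i j) else 0) +
      if j < i then x j * x i * c (-(↑q⁻¹ : K) • g i j) else 0 := by
    intro i j
    rcases lt_trichotomy i j with h | rfl | h
    · simp [h, h.le]
    · simp [hx.sq]
    · rw [hx.swap j i h]; simp [h, h.le]
  rw [sum_congr rfl fun i _ => sum_congr rfl fun j _ => h i j]
  simp only [sum_add_distrib]
  rw [sum_comm (f := fun i j => if j < i then _ else _)]
  simp only [← sum_add_distrib]
  refine sum_congr rfl fun i _ => sum_congr rfl fun j _ => ?_
  split_ifs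
  · rw [← mul_add, ← map_add, neg_smul, ← sub_eq_add_neg]
  · simp

/-- The column forms of a `q`-Manin matrix satisfy the relations of the Grassmann variables; this
is the meaning of the Manin relations. -/
theorem IsQManin.qAnticommute [Fintype ι] {E : Matrix ι κ F} (hE : IsQManin q E)
    (hx : QAnticommute q x) (hc : ∀ i f, Commute (x i) (c f)) :
    QAnticommute q (columnForm x c E) := by
  refine ⟨fun a => ?_, fun a b h => ?_⟩
  · rw [columnForm_mul hc, hx.sum_sum]
    refine sum_eq_zero fun i _ => sum_eq_zero fun j _ => ?_
    split_ifs with hij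
    · rw [hE.col i j a hij, sub_self, map_zero, mul_zero]
    · rfl
  · rw [columnForm_mul hc, columnForm_mul hc, hx.sum_sum, hx.sum_sum, smul_sum]
    refine sum_congr rfl fun i _ => ?_
    rw [smul_sum]
    refine sum_congr rfl fun j _ => ?_
    split_ifs with hij
    · have h1 : E i b * E j a - (↑q⁻¹ : K) • (E j b * E i a) =
          (-(↑q⁻¹ : K)) • (E i a * E j b - (↑q⁻¹ : K) • (E j a * E i b)) := by
        rw [← sub_eq_iff_eq_add'.2 (sub_eq_iff_eq_add.1 (hE.cross i j a b hij h))]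
        simp only [smul_sub, smul_smul, neg_smul, neg_mul, Units.inv_mul, one_smul]
        abel
      rw [h1, map_smul, mul_smul_comm]
    · rw [smul_zero]

/-- The quantum determinant as the coefficient of the top form. No relations between the entries
of `E` are needed. -/
theorem prod_columnForm {r : ℕ} {x : Fin r → G} (hx : QAnticommute q x)
    (hc : ∀ i f, Commute (x i) (c f)) (E : Matrix (Fin r) (Fin r) F) :
    (List.ofFn (columnForm x c E)).prod = (List.ofFn x).prod * c (qDet q E) := by
  classical
  rw [prod_columnForm_eq_sum hc, qDet, map_sum, mul_sum]
  symm
  refine sum_of_injOn (fun σ : Equiv.Perm (Fin r) => (σ : Fin r → Fin r))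
    (fun _ _ _ _ h => DFunLike.coe_injective h) (fun _ _ => by simp) ?_ ?_
  · intro f _ hf
    rw [hx.prod_not_injective, zero_mul]
    intro hi
    exact hf ⟨Equiv.ofBijective f (Finite.injective_iff_bijective.1 hi), by simp, rfl⟩
  · intro σ _
    rw [hx.prod_perm σ, map_smul, mul_smul_comm, smul_mul_assoc]

/-- A `q`-Manin matrix with a right inverse has a right invertible quantum determinant: the product
of the `x_i` is a right multiple of the product of the column forms. -/
theorem IsQManin.exists_qDet_mul_eq_one {r : ℕ} {E T : Matrix (Fin r) (Fin r) F}
    (hE : IsQManin q E) (hET : E * T = 1) : ∃ e, qDet q E * e = 1 := by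
  set x : Fin r → Module.End K (Finset (Fin r) → F) := grassmannGen F q
  set c := grassmannCoeff K F (Fin r)
  have hx : QAnticommute q x := grassmannGen_qAnticommute q
  have hc : ∀ i f, Commute (x i) (c f) := grassmannGen_commute q
  set y := columnForm x c E
  have hy : QAnticommute q y := hE.qAnticommute hx hc
  -- Multiplying `E * T = 1` by the row of the `x_i` expresses each `x_a` by the `y_j`.
  have hxy : ∀ a, x a = ∑ j, y j * c (T j a) := by
    intro a
    simp only [y, columnForm, sum_mul, mul_assoc, ← map_mul]
    rw [sum_comm]
    simp only [← mul_sum, ← map_sum, ← Matrix.mul_apply, hET]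
    rw [sum_eq_single a (fun b _ hb => by rw [Matrix.one_apply_ne hb, map_zero, mul_zero])
      (by simp)]
    simp
  -- The coefficient `c (T j a)` is moved to the right through `x`s, never through `y`s.
  have key : ∀ l₂ l₁ : List (Fin r), l₁.length + l₂.length = r →
      ∃ e : F, (l₁.map y).prod * (l₂.map x).prod = (List.ofFn y).prod * c e := by
    intro l₂
    induction l₂ with
    | nil =>
      intro l₁ h
      obtain ⟨f, rfl⟩ : ∃ f : Fin r → Fin r, l₁ = List.ofFn f :=
        ⟨fun i => l₁[i.1]'(by simp at h; omega), by
          apply List.ext_getElem <;> simp at h ⊢; exact h⟩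
      rw [List.map_ofFn, List.map_nil, List.prod_nil, mul_one]
      by_cases hf : Function.Injective f
      · have h2 := hy.prod_perm (Equiv.ofBijective f (Finite.injective_iff_bijective.1 hf))
        refine ⟨algebraMap K F (permCoeff q (Equiv.ofBijective f
          (Finite.injective_iff_bijective.1 hf))), ?_⟩
        rw [AlgHom.commutes, ← Algebra.commutes, ← Algebra.smul_def, ← h2]
        rfl
      · exact ⟨0, by rw [map_zero, mul_zero]; exact hy.prod_not_injective hf⟩
    | cons a l ih =>
      intro l₁ h
      have hj : ∀ j, ∃ e : F, (l₁.map y).prod * (y j * (l.map x).prod) =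
          (List.ofFn y).prod * c e := by
        intro j
        obtain ⟨e, he⟩ := ih (l₁ ++ [j]) (by simp at h ⊢; omega)
        exact ⟨e, by rw [← he]; simp [mul_assoc]⟩
      choose e he using hj
      refine ⟨∑ j, e j * T j a, ?_⟩
      rw [List.map_cons, List.prod_cons, hxy a, sum_mul, mul_sum, map_sum, mul_sum]
      refine sum_congr rfl fun j _ => ?_
      have hcomm : Commute (c (T j a)) (l.map x).prod := by
        refine Commute.list_prod_right _ _ fun z hz => ?_
        obtain ⟨i, _, rfl⟩ := List.mem_map.1 hz
        exact (hc i _).symm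
      rw [mul_assoc, hcomm.eq, ← mul_assoc (y j), ← mul_assoc, he, mul_assoc, ← map_mul]
  obtain ⟨e, he⟩ := key (List.ofFn id) [] (by simp)
  refine ⟨e, grassmannGen_top_injective q r ?_⟩
  rw [map_mul, ← mul_assoc, ← prod_columnForm hx hc, map_one, mul_one]
  rw [List.map_nil, List.prod_nil, one_mul, List.map_ofFn] at he
  exact he.symm

/-- The quantum determinant of a `q`-Manin matrix may be computed with the factors of all products
in the opposite order, if `q` is replaced by `q⁻¹` in the coefficients. -/
theorem IsQManin.qDet_op {r : ℕ} {E : Matrix (Fin r) (Fin r) F} (hE : IsQManin q E) :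
    qDet q⁻¹ (E.map (MulOpposite.op : F → Fᵐᵒᵖ)) = MulOpposite.op (qDet q E) := by
  set x : Fin r → Module.End K (Finset (Fin r) → F) := grassmannGen F q
  set c := grassmannCoeff K F (Fin r)
  have hx : QAnticommute q x := grassmannGen_qAnticommute q
  have hc : ∀ i f, Commute (x i) (c f) := grassmannGen_commute q
  have hy := hE.qAnticommute hx hc
  have hop := prod_columnForm (c := AlgHom.op c) hx.op (fun i f => ?_)
    (E.map (MulOpposite.op : F → Fᵐᵒᵖ))
  · have hrev : ∀ u : Fin r → Module.End K (Finset (Fin r) → F),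
        (List.ofFn fun i => MulOpposite.op (u i)).prod =
          MulOpposite.op (((List.ofFn id).reverse.map u).prod) := by
      intro u
      rw [MulOpposite.op_list_prod, List.map_reverse, List.map_reverse, List.reverse_reverse,
        List.map_ofFn, List.map_ofFn]
      rfl
    have hcol : columnForm (fun a => MulOpposite.op (x a)) (AlgHom.op c)
        (E.map (MulOpposite.op : F → Fᵐᵒᵖ)) = fun j => MulOpposite.op (columnForm x c E j) := by
      funext j
      simp only [columnForm, Finset.op_sum]
      refine sum_congr rfl fun i _ => ?_
      rw [(hc i _).eq]
      rfl
    have hs : ((List.ofFn id).reverse.insertionSort (· ≤ ·) : List (Fin r)) = List.ofFn id := by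
      refine List.Perm.eq_of_pairwise (le := (· ≤ ·)) (fun a b _ _ => le_antisymm)
        (List.pairwise_insertionSort _ _) ?_
        ((List.perm_insertionSort _ _).trans (List.reverse_perm _))
      rw [List.pairwise_ofFn]
      exact fun i j h => h.le
    rw [hcol, hrev, hrev, hy.prod_eq_sorted, hx.prod_eq_sorted, hs, List.map_ofFn, List.map_ofFn]
      at hop
    -- Both products in decreasing order acquire the same power of `-q⁻¹`, which cancels.
    have h2 := congrArg MulOpposite.unop hop
    simp only [MulOpposite.unop_mul, MulOpposite.unop_op, mul_smul_comm] at h2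
    have h3 := smul_right_injective _ (pow_ne_zero _ (neg_ne_zero.2 q⁻¹.ne_zero)) h2
    have h4 : Commute (MulOpposite.unop (AlgHom.op c (qDet q⁻¹ (E.map MulOpposite.op))))
        (List.ofFn x).prod := by
      refine Commute.list_prod_right _ _ fun z hz => ?_
      obtain ⟨i, rfl⟩ := List.mem_ofFn.1 hz
      exact (hc i _).symm
    have h5 : (List.ofFn (columnForm x c E)).prod = _ := h3
    rw [prod_columnForm hx hc] at h5
    apply MulOpposite.unop_injective
    refine (grassmannGen_top_injective q r (h5.trans h4.eq)).symm
  · exact ((hc i _).op)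

end QManin

/-! ### Schur's formula for the quantum determinant -/

section Schur

variable {K F : Type*} [Field K] [Ring F] [Algebra K F]

/-- Schur's determinant formula for a `q`-Manin matrix whose leading block has a right inverse. -/
theorem IsQManin.qDet_schur {q : Kˣ} {k m : ℕ} {E : Matrix (Fin (k + m)) (Fin (k + m)) F}
    (hE : IsQManin q E) {T : Matrix (Fin k) (Fin k) F}
    (hT : E.submatrix (Fin.castAdd m) (Fin.castAdd m) * T = 1) :
    qDet q E = qDet q (E.submatrix (Fin.castAdd m) (Fin.castAdd m)) *
      qDet q (E.submatrix (Fin.natAdd k) (Fin.natAdd k) -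
        E.submatrix (Fin.natAdd k) (Fin.castAdd m) * T *
          E.submatrix (Fin.castAdd m) (Fin.natAdd k)) := by
  set A := E.submatrix (Fin.castAdd m) (Fin.castAdd m)
  set B := E.submatrix (Fin.castAdd m) (Fin.natAdd k)
  set C := E.submatrix (Fin.natAdd k) (Fin.castAdd m)
  set Z := E.submatrix (Fin.natAdd k) (Fin.natAdd k) - C * T * B
  set x : Fin (k + m) → Module.End K (Finset (Fin (k + m)) → F) := grassmannGen F q
  set c := grassmannCoeff K F (Fin (k + m))
  have hx : QAnticommute q x := grassmannGen_qAnticommute q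
  have hc : ∀ i f, Commute (x i) (c f) := grassmannGen_commute q
  set y := columnForm x c E
  have hy : QAnticommute q y := hE.qAnticommute hx hc
  have hxh : QAnticommute q (x ∘ Fin.castAdd m) := hx.comp_strictMono (Fin.strictMono_castAdd m)
  have hxt : QAnticommute q (x ∘ Fin.natAdd k) := hx.comp_strictMono (Fin.strictMono_natAdd k)
  have split : ∀ u : Fin (k + m) → Module.End K (Finset (Fin (k + m)) → F), (List.ofFn u).prod =
      (List.ofFn (u ∘ Fin.castAdd m)).prod * (List.ofFn (u ∘ Fin.natAdd k)).prod := by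
    intro u
    rw [List.ofFn_add, List.prod_append]
    rfl
  have hcl : ∀ (l : List (Fin (k + m))) f, Commute (c f) (l.map x).prod := by
    intro l f
    refine Commute.list_prod_right _ _ fun z hz => ?_
    obtain ⟨i, _, rfl⟩ := List.mem_map.1 hz
    exact (hc i _).symm
  -- The column forms of the Schur complement are the last column forms of `E`, corrected by
  -- multiples of the first ones.
  have hz : ∀ j, columnForm (x ∘ Fin.natAdd k) c Z j =
      y (Fin.natAdd k j) - ∑ a, y (Fin.castAdd m a) * c ((T * B) a j) := by
    intro j
    have h1 : ∀ i, ∑ a, E i (Fin.castAdd m a) * (T * B) a j =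
        (E.submatrix id (Fin.castAdd m) * (T * B)) i j := fun i => rfl
    have h2 : ∑ a, y (Fin.castAdd m a) * c ((T * B) a j) =
        ∑ i, x i * c ((E.submatrix id (Fin.castAdd m) * (T * B)) i j) := by
      simp only [y, columnForm, sum_mul, mul_assoc, ← map_mul]
      rw [sum_comm]
      simp only [← mul_sum, ← map_sum, h1]
    have h3 : ∀ i, (E.submatrix id (Fin.castAdd m) * (T * B)) (Fin.castAdd m i) j = B i j := by
      intro i
      change (A * (T * B)) i j = _
      rw [← Matrix.mul_assoc, hT, Matrix.one_mul]
    have h4 : ∀ i, (E.submatrix id (Fin.castAdd m) * (T * B)) (Fin.natAdd k i) j =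
        (C * T * B) i j := by
      intro i
      change (C * (T * B)) i j = _
      rw [Matrix.mul_assoc]
    rw [h2]
    simp only [y, columnForm]
    rw [Fin.sum_univ_add, Fin.sum_univ_add]
    simp only [h3, h4]
    rw [add_sub_add_comm]
    have h5 : ∑ i, x (Fin.castAdd m i) * c (E (Fin.castAdd m i) (Fin.natAdd k j)) -
        ∑ i, x (Fin.castAdd m i) * c (B i j) = 0 := sub_self _
    rw [h5, zero_add, ← sum_sub_distrib]
    refine sum_congr rfl fun i _ => ?_
    rw [← mul_sub, ← map_sub]
    rfl
  -- The corrections do not matter behind the product of the first column forms.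
  have htail : ∀ l : List (Fin m),
      (List.ofFn (y ∘ Fin.castAdd m)).prod * (l.map (columnForm (x ∘ Fin.natAdd k) c Z)).prod =
        (List.ofFn (y ∘ Fin.castAdd m)).prod * (l.map (y ∘ Fin.natAdd k)).prod := by
    intro l
    induction l using List.reverseRecOn with
    | nil => rfl
    | append_singleton l j ih =>
      simp only [List.map_append, List.prod_append, List.map_cons, List.map_nil,
        List.prod_singleton]
      rw [← mul_assoc, ih, hz, mul_sub, mul_sum, mul_assoc]
      refine sub_eq_self.2 (sum_eq_zero fun a _ => ?_)
      have h0 : ((List.ofFn (Fin.castAdd m) ++ l.map (Fin.natAdd k) ++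
          [Fin.castAdd m a]).map y).prod = 0 := by
        refine hy.prod_eq_zero fun h => ?_
        rw [List.nodup_append] at h
        exact h.2.2 (Fin.castAdd m a) (by simp) (Fin.castAdd m a) (by simp) rfl
      simp only [List.map_append, List.prod_append, List.map_cons, List.map_nil,
        List.prod_singleton, List.map_map, List.map_ofFn] at h0
      rw [← mul_assoc, h0, zero_mul]
  -- In front of the product of the last variables, only the first rows of `E` matter.
  have hhead : ∀ (l : List (Fin k)) (l' : List (Fin (k + m))),
      (l.map (y ∘ Fin.castAdd m)).prod * ((l'.map x).prod *
          (List.ofFn (x ∘ Fin.natAdd k)).prod) =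
        (l.map (columnForm (x ∘ Fin.castAdd m) c A)).prod * ((l'.map x).prod *
          (List.ofFn (x ∘ Fin.natAdd k)).prod) := by
    intro l
    induction l using List.reverseRecOn with
    | nil => intro l'; rfl
    | append_singleton l a ih =>
      intro l'
      set P := (l'.map x).prod * (List.ofFn (x ∘ Fin.natAdd k)).prod with hP
      have hP' : P = ((l' ++ List.ofFn (Fin.natAdd k)).map x).prod := by
        rw [List.map_append, List.prod_append, List.map_ofFn]
      have hcP : ∀ f, Commute (c f) P := fun f => hP' ▸ hcl _ f
      have h1 : y (Fin.castAdd m a) * P =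
          ∑ i, x (Fin.castAdd m i) * P * c (A i a) := by
        simp only [y, columnForm]
        rw [Fin.sum_univ_add, add_mul, sum_mul, sum_mul]
        simp only [mul_assoc, (hcP _).eq]
        refine add_eq_left.2 (sum_eq_zero fun i _ => ?_)
        rw [← mul_assoc, hP', hx.mul_prod_eq_zero (by simp), zero_mul]
      have h2 : columnForm (x ∘ Fin.castAdd m) c A a * P =
          ∑ i, x (Fin.castAdd m i) * P * c (A i a) := by
        rw [columnForm, sum_mul]
        simp only [mul_assoc, (hcP _).eq]
        rfl
      simp only [List.map_append, List.prod_append, List.map_cons, List.map_nil,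
        List.prod_singleton, mul_assoc]
      rw [h2, Function.comp_apply, h1, mul_sum, mul_sum]
      refine sum_congr rfl fun i _ => ?_
      have := ih (Fin.castAdd m i :: l')
      rw [List.map_cons, List.prod_cons, mul_assoc] at this
      rw [← mul_assoc, this, mul_assoc]
  have h1 := htail (List.ofFn id)
  have h2 := hhead (List.ofFn id) []
  simp only [List.map_ofFn, Function.comp_id, List.map_nil, List.prod_nil, one_mul] at h1 h2
  refine grassmannGen_top_injective q (k + m) ?_
  rw [← prod_columnForm hx hc, split y, ← h1, prod_columnForm hxt fun i f => hc _ f, ← mul_assoc,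
    h2, prod_columnForm hxh fun i f => hc _ f, map_mul, ← mul_assoc, split x]
  have h6 := hcl (List.ofFn (Fin.natAdd k)) (qDet q A)
  rw [List.map_ofFn] at h6
  rw [mul_assoc (List.ofFn _).prod, h6.eq, ← mul_assoc]

end Schur

/-! ### Inversion of block matrices -/

section Blocks

variable {F ι κ : Type*} [Ring F] [Fintype ι] [Fintype κ] [DecidableEq ι] [DecidableEq κ]

/-- If two mutually inverse block matrices are given and the lower right block of the second one
has inverse `Z`, then the upper left block of the first one is invertible, with the Schur
complement as inverse, and `Z` is its own Schur complement. -/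
theorem block_inverse {A : Matrix ι ι F} {B : Matrix ι κ F} {C : Matrix κ ι F} {D : Matrix κ κ F}
    {A' : Matrix ι ι F} {B' : Matrix ι κ F} {C' : Matrix κ ι F} {W Z : Matrix κ κ F}
    (h : Matrix.fromBlocks A B C D * Matrix.fromBlocks A' B' C' W = 1)
    (h' : Matrix.fromBlocks A' B' C' W * Matrix.fromBlocks A B C D = 1)
    (hWZ : W * Z = 1) (hZW : Z * W = 1) :
    A * (A' - B' * Z * C') = 1 ∧ (A' - B' * Z * C') * A = 1 ∧
      Z = D - C * (A' - B' * Z * C') * B := by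
  rw [Matrix.fromBlocks_multiply, ← Matrix.fromBlocks_one, Matrix.fromBlocks_inj] at h h'
  obtain ⟨h1, h2, -, -⟩ := h
  obtain ⟨h1', -, h3', h4'⟩ := h'
  have e1 : A * B' = -(B * W) := eq_neg_of_add_eq_zero_left h2
  have e2 : C' * A = -(W * C) := eq_neg_of_add_eq_zero_left h3'
  have hA : A * (A' - B' * Z * C') = 1 := by
    rw [Matrix.mul_sub, ← Matrix.mul_assoc, ← Matrix.mul_assoc, e1, Matrix.neg_mul,
      Matrix.mul_assoc B, hWZ, Matrix.mul_one, Matrix.neg_mul, sub_neg_eq_add, h1]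
  have e3 : C = -(Z * C' * A) := by
    rw [Matrix.mul_assoc, e2, Matrix.mul_neg, neg_neg, ← Matrix.mul_assoc, hZW, Matrix.one_mul]
  refine ⟨hA, ?_, ?_⟩
  · rw [Matrix.sub_mul, Matrix.mul_assoc, e2, Matrix.mul_neg, Matrix.mul_assoc B',
      ← Matrix.mul_assoc Z, hZW, Matrix.one_mul, sub_neg_eq_add, h1']
  · have e4 : C * (A' - B' * Z * C') = -(Z * C') := by
      conv_lhs => rw [e3]
      rw [Matrix.neg_mul, Matrix.mul_assoc, hA, Matrix.mul_one]
    rw [e4, Matrix.neg_mul, sub_neg_eq_add, Matrix.mul_assoc, eq_sub_of_add_eq h4',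
      Matrix.mul_sub, Matrix.mul_one, ← Matrix.mul_assoc, hZW, Matrix.one_mul]
    abel

end Blocks

/-! ### Multiplicative maps and Berezinians -/

section Functoriality

variable {K F R : Type*} [Field K] [Ring F] [Algebra K F] [Ring R] [Algebra K R]

/-- A linear map that is multiplicative when the left factor is one of the `u i` is multiplicative
when the left factor is a product of them. -/
theorem map_prod_ofFn_mul {r : ℕ} (f : F →ₗ[K] R) (u : Fin r → F)
    (h : ∀ i x, f (u i * x) = f (u i) * f x) (x : F) :
    f ((List.ofFn u).prod * x) = (List.ofFn fun i => f (u i)).prod * f x := by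
  induction r with
  | zero => simp
  | succ r ih =>
    rw [List.ofFn_succ, List.ofFn_succ, List.prod_cons, List.prod_cons, mul_assoc, h,
      ih (fun i => u i.succ) fun i => h _, mul_assoc]

theorem map_qDet_mul {q : Kˣ} {r : ℕ} (f : F →ₗ[K] R) (A : Matrix (Fin r) (Fin r) F)
    (h : ∀ i j x, f (A i j * x) = f (A i j) * f x) (x : F) :
    f (qDet q A * x) = qDet q (A.map f) * f x := by
  simp only [qDet, sum_mul, map_sum, smul_mul_assoc, map_smul]
  refine sum_congr rfl fun σ _ => ?_
  rw [map_prod_ofFn_mul f _ fun i => h _ _]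
  rfl

theorem map_qDetRow_mul {q : Kˣ} {r : ℕ} (f : F →ₗ[K] R) (A : Matrix (Fin r) (Fin r) F)
    (h : ∀ i j x, f (A i j * x) = f (A i j) * f x) (x : F) :
    f (qDetRow q A * x) = qDetRow q (A.map f) * f x := by
  simp only [qDetRow, sum_mul, map_sum, smul_mul_assoc, map_smul]
  refine sum_congr rfl fun σ _ => ?_
  rw [map_prod_ofFn_mul f _ fun i => h _ _]
  rfl

theorem par_castAdd {m n : ℕ} (i : Fin m) : par m (Fin.castAdd n i) = 0 := by
  simp [par]

theorem par_natAdd {m n : ℕ} (i : Fin n) : par m (Fin.natAdd m i) = 1 := by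
  simp [par]

theorem map_qBer {q : Kˣ} {m n : ℕ} (f : F →ₗ[K] R) (hf : f 1 = 1)
    {A B : Matrix (Fin (m + n)) (Fin (m + n)) F}
    (hA : ∀ i j, par m i = par m j → ∀ x, f (A i j * x) = f (A i j) * f x)
    (hB : ∀ i j, par m i = par m j → ∀ x, f (B i j * x) = f (B i j) * f x) :
    f (qBer q m n A B) = qBer q m n (A.map f) (B.map f) := by
  rw [qBer, map_qDet_mul f (A.submatrix (Fin.castAdd n) (Fin.castAdd n))
      fun i j => hA (Fin.castAdd n i) (Fin.castAdd n j) (by rw [par_castAdd, par_castAdd]),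
    ← mul_one (qDetRow q _), map_qDetRow_mul f (B.submatrix (Fin.natAdd m) (Fin.natAdd m))
      fun i j => hB (Fin.natAdd m i) (Fin.natAdd m j) (by rw [par_natAdd, par_natAdd]),
    hf, mul_one]
  rfl

/-- The even block of a `q`-super Manin matrix is a `q`-Manin matrix. -/
theorem isQManin_even {q : Kˣ} {m n : ℕ} {A : Matrix (Fin (m + n)) (Fin (m + n)) F}
    (hA : ∀ x y, ManinRel q m n A x y → x = y) :
    IsQManin q (A.submatrix (Fin.castAdd n) (Fin.castAdd n)) := by
  have e1 : ∀ {N : ℕ} {i j : Fin N}, i < j → eps i j = -1 := fun h => by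
    simp [eps, h, h.not_gt]
  have e2 : ∀ {N : ℕ} {i j : Fin N}, i < j → eps j i = 1 := fun h => by simp [eps, h]
  have lt : ∀ {i j : Fin m}, i < j → Fin.castAdd n i < Fin.castAdd n j := fun h =>
    Fin.strictMono_castAdd n h
  refine ⟨fun i j a h => ?_, fun i j a b hij hab => ?_⟩
  · have h1 := hA _ _ (.col (Fin.castAdd n i) (Fin.castAdd n j) (Fin.castAdd n a) (par_castAdd a))
    simpa [qs, par_castAdd, e1 (lt h), sub_eq_zero] using h1
  · have h1 := hA _ _ (.cross (Fin.castAdd n i) (Fin.castAdd n a) (Fin.castAdd n j)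
      (Fin.castAdd n b))
    simpa [qs, par_castAdd, e1 (lt hij), e2 (lt hab)] using h1

end Functoriality

/-! ### The maps `ω` and `ψ_k` and the blocks of the generator matrices -/

section Localization

variable {K : Type*} [Field K] (q : Kˣ) (k m n : ℕ)

theorem HopfEnv.lift_gen {R : Type*} [Ring R] [Algebra K R] {q : Kˣ} {m n : ℕ}
    (A B : Matrix (Fin (m + n)) (Fin (m + n)) R)
    (h : ∀ x y : R, HopfRel q m n A B x y → x = y) (s : Bool) (i j : Fin (m + n)) :
    HopfEnv.lift A B h (gen q m n s i j) = (if s then B else A) i j := by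
  rw [gen, Matrix.map_apply, HopfEnv.lift, RingQuot.liftAlgHom_mkAlgHom_apply]
  simp [freeGen]

theorem locOmega_one : locOmega q k m n 1 = 1 := by
  simp [locOmega]

theorem locOmega_gen (u : LocGen k m n) :
    locOmega q k m n (locGen q k m n u) = locGen q k m n (locSwap u) := by
  have h := locOmega_gen_mul q k m n u 1
  rwa [mul_one, locOmega_one, map_one, one_mul] at h

variable {k m n}

theorem locPar_locSwap (u : LocGen k m n) : locPar (locSwap u) = locPar u := by
  rcases u with ⟨s, i, j⟩ | ⟨s, i, j⟩ <;> rfl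

variable {q}

theorem locOmega_even_mul {u : LocGen k m n} (hu : Even (locPar u)) (x : Loc q k m n) :
    locOmega q k m n (locGen q k m n u * x) =
      locOmega q k m n x * locGen q k m n (locSwap u) := by
  obtain ⟨p, hp⟩ := hu
  rw [locOmega_gen_mul, hp, ← two_mul, pow_mul, locParityAut_sq, one_pow]
  rfl

/-- The operator attached to `x` by `ω` multiplies from the right, so that it commutes with left
multiplication by even elements. -/
theorem locOmegaOp_even_mul {g : Loc q k m n} (hg : locParityAut q k m n g = g)
    (x z : Loc q k m n) :
    locOmegaOp q k m n x (g * z) = g * locOmegaOp q k m n x z := by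
  obtain ⟨a, rfl⟩ := RingQuot.mkAlgHom_surjective K (LocRel q k m n) x
  induction a using FreeAlgebra.induction generalizing z with
  | grade0 r => simp
  | grade1 u =>
    have h : RingQuot.mkAlgHom K (LocRel q k m n) (FreeAlgebra.ι K u) = locGen q k m n u := by
      rcases u with ⟨s, i, j⟩ | ⟨s, i, j⟩ <;> rfl
    have hp : ∀ p : ℕ, (locParityAut q k m n ^ p) g = g := by
      intro p
      induction p with
      | zero => rfl
      | succ p ih => rw [pow_succ, AlgHom.mul_apply, hg, ih]
    rw [h, locOmegaOp_gen, superMulRight_apply, superMulRight_apply, map_mul, hp, mul_assoc]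
  | mul a b ha hb => 
    rw [map_mul (RingQuot.mkAlgHom K _), map_mul (locOmegaOp q k m n), Module.End.mul_apply,
      Module.End.mul_apply, hb, ha]
  | add a b ha hb => 
    rw [map_add, map_add, LinearMap.add_apply, LinearMap.add_apply, ha, hb, mul_add]

theorem locOmega_mul_even {u : LocGen k m n} (hu : Even (locPar u)) (x : Loc q k m n) :
    locOmega q k m n (x * locGen q k m n u) =
      locGen q k m n (locSwap u) * locOmega q k m n x := by
  have hg : locParityAut q k m n (locGen q k m n (locSwap u)) = locGen q k m n (locSwap u) := by
    rw [locParityAut_gen, locPar_locSwap, hu.neg_one_pow, one_smul]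
  have h1 : locOmegaOp q k m n (locGen q k m n u) 1 = locGen q k m n (locSwap u) * 1 := by
    rw [mul_one]
    exact locOmega_gen q k m n u
  change locOmegaOp q k m n (x * locGen q k m n u) 1 = _ * locOmegaOp q k m n x 1
  rw [map_mul, Module.End.mul_apply, h1, locOmegaOp_even_mul hg]

variable (q k)

theorem phi_gen (s : Bool) (i j : Fin (m + n)) : phi q k m n (gen q m n s i j) =
    locGen q k m n (if s then .inr (false, i, j) else .inl (false, shift k i, shift k j)) := by
  rw [phi, HopfEnv.lift_gen]
  cases s <;> rfl

theorem psi_one : psi q k m n 1 = 1 := by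
  simp [psi, omega_one, locOmega_one]

theorem psi_gen (s : Bool) (i j : Fin (m + n)) : psi q k m n (gen q m n s i j) =
    if s then big q k m n true (shift k i) (shift k j) else small q k m n true i j := by
  change locOmega q k m n (phi q k m n (omega q m n (gen q m n s i j))) = _
  rw [omega_gen, phi_gen, locOmega_gen]
  cases s <;> rfl

variable {q k}

/-- `ψ_k` is multiplicative, being the composite of two super antihomomorphisms and a homomorphism;
here this is only recorded for even generators, where no signs appear. -/
theorem psi_gen_mul (s : Bool) (i j : Fin (m + n)) (hij : par m i = par m j)
    (x : HopfEnv q m n) :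
    psi q k m n (gen q m n s i j * x) = psi q k m n (gen q m n s i j) * psi q k m n x := by
  have h : psi q k m n (gen q m n s i j) = locOmega q k m n (phi q k m n (gen q m n (!s) i j)) := by
    rw [← omega_gen]; rfl
  rw [h]
  change locOmega q k m n (phi q k m n (omega q m n (gen q m n s i j * x))) =
    _ * locOmega q k m n (phi q k m n (omega q m n x))
  rw [omega_gen_mul, hij, ← two_mul, pow_mul, parityAut_sq, one_pow, AlgHom.one_apply, map_mul,
    phi_gen, locOmega_mul_even, locOmega_gen]
  cases s <;> simp [locPar, par_shift, hij]

theorem psi_Ber : psi q k m n (Ber q m n) = qBer q m n (small q k m n true)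
    ((big q k m n true).submatrix (shift k) (shift k)) := by
  rw [Ber, map_qBer _ (psi_one q k) (psi_gen_mul false) (psi_gen_mul true)]
  congr 1 <;> ext i j <;> simp [psi_gen]

theorem toLoc_Ber : toLoc q k m n (Ber q (k + m) n) =
    qBer q (k + m) n (big q k m n false) (big q k m n true) := by
  have h := map_qBer (q := q) (toLoc q k m n).toLinearMap (map_one (toLoc q k m n))
    (A := gen q (k + m) n false) (B := gen q (k + m) n true)
    (fun i j _ x => map_mul (toLoc q k m n) _ x) (fun i j _ x => map_mul (toLoc q k m n) _ x)
  refine h.trans ?_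
  congr 1 <;> ext i j
  · exact HopfEnv.lift_gen _ _ (big_rel q k m n) false i j
  · exact HopfEnv.lift_gen _ _ (big_rel q k m n) true i j

/-- The indices of the large matrix, split into the first `k` and the last `m + n` ones. -/
def blockEquiv (k m n : ℕ) : Fin k ⊕ Fin (m + n) ≃ Fin (k + m + n) :=
  finSumFinEquiv.trans (finCongr (Nat.add_assoc k m n).symm)

theorem fromBlocks_submatrix {F : Type*} (A : Matrix (Fin (k + m + n)) (Fin (k + m + n)) F) :
    Matrix.fromBlocks (A.submatrix (lead m n) (lead m n)) (A.submatrix (lead m n) (shift k))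
      (A.submatrix (shift k) (lead m n)) (A.submatrix (shift k) (shift k)) =
      A.submatrix (blockEquiv k m n) (blockEquiv k m n) := by
  ext (i | i) (j | j) <;> rfl

theorem fromBlocks_mul_eq_one {F : Type*} [Ring F]
    {A B : Matrix (Fin (k + m + n)) (Fin (k + m + n)) F} (h : A * B = 1) :
    Matrix.fromBlocks (A.submatrix (lead m n) (lead m n)) (A.submatrix (lead m n) (shift k))
      (A.submatrix (shift k) (lead m n)) (A.submatrix (shift k) (shift k)) *
    Matrix.fromBlocks (B.submatrix (lead m n) (lead m n)) (B.submatrix (lead m n) (shift k))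
      (B.submatrix (shift k) (lead m n)) (B.submatrix (shift k) (shift k)) = 1 := by
  rw [fromBlocks_submatrix, fromBlocks_submatrix, Matrix.submatrix_mul_equiv, h,
    Matrix.submatrix_one_equiv]

variable (q k m n)

theorem big_mul_big (s : Bool) : big q k m n s * big q k m n (!s) = 1 := by
  cases s
  · exact Matrix.ext fun i j => big_rel q k m n _ _ (.mul_inv i j)
  · exact Matrix.ext fun i j => big_rel q k m n _ _ (.inv_mul i j)

theorem isQManin_lead_false :
    IsQManin q ((big q k m n false).submatrix (lead (k := k) m n) (lead m n)) :=
  (isQManin_even fun _ _ h => big_rel q k m n _ _ (.manin h)).submatrix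
    (Fin.strictMono_castAdd m) (Fin.strictMono_castAdd m)

theorem isQManin_lead_true :
    IsQManin q⁻¹ ((big q k m n true).submatrix (lead (k := k) m n) (lead m n)) :=
  (isQManin_even fun _ _ h => big_rel q k m n _ _ (.manin_inv h)).submatrix
    (Fin.strictMono_castAdd m) (Fin.strictMono_castAdd m)

/-- The leading block of `M` is invertible, and the inverse of the lower right block of `M⁻¹` is
its Schur complement. -/
theorem exists_inverse_lead : ∃ T : Matrix (Fin k) (Fin k) (Loc q k m n),
    (big q k m n false).submatrix (lead m n) (lead m n) * T = 1 ∧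
    T * (big q k m n false).submatrix (lead m n) (lead m n) = 1 ∧
    small q k m n true = (big q k m n false).submatrix (shift k) (shift k) -
      (big q k m n false).submatrix (shift k) (lead m n) * T *
        (big q k m n false).submatrix (lead m n) (shift k) :=
  ⟨_, block_inverse (fromBlocks_mul_eq_one (big_mul_big q k m n false))
    (fromBlocks_mul_eq_one (big_mul_big q k m n true))
    (Matrix.ext fun i j => dual_rel q k m n _ _ (.inv_mul i j))
    (Matrix.ext fun i j => dual_rel q k m n _ _ (.mul_inv i j))⟩

/-- The leading block of `M⁻¹` is invertible because the lower right block of `M` is. -/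
theorem exists_inverse_lead_true : ∃ T : Matrix (Fin k) (Fin k) (Loc q k m n),
    (big q k m n true).submatrix (lead m n) (lead m n) * T = 1 :=
  ⟨_, (block_inverse (fromBlocks_mul_eq_one (big_mul_big q k m n true))
    (fromBlocks_mul_eq_one (big_mul_big q k m n false))
    (Matrix.ext fun i j => block_rel q k m n _ _ (.mul_inv i j))
    (Matrix.ext fun i j => block_rel q k m n _ _ (.inv_mul i j))).1⟩

/-- A right inverse of the quantum determinant comes from the inverse of the leading block of `M`.
A left inverse is the image under the antipode `ω` of a right inverse of the quantum determinant of
the leading block of `M⁻¹`. -/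
theorem isUnit_qDet_lead :
    IsUnit (qDet q ((big q k m n false).submatrix (lead (k := k) m n) (lead m n))) := by
  obtain ⟨T, hT, -⟩ := exists_inverse_lead q k m n
  obtain ⟨e, he⟩ := (isQManin_lead_false q k m n).exists_qDet_mul_eq_one hT
  obtain ⟨T', hT'⟩ := exists_inverse_lead_true q k m n
  obtain ⟨e', he'⟩ := (isQManin_lead_true q k m n).exists_qDet_mul_eq_one hT'
  -- The antipode reverses products of even elements, hence is multiplicative into the opposite
  -- algebra.
  let f : Loc q k m n →ₗ[K] (Loc q k m n)ᵐᵒᵖ :=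
    (MulOpposite.opLinearEquiv K).toLinearMap ∘ₗ locOmega q k m n
  have hf : ∀ x, f x = MulOpposite.op (locOmega q k m n x) := fun x => rfl
  have hgen : ∀ i j : Fin k, big q k m n true (lead m n i) (lead m n j) =
      locGen q k m n (.inl (true, lead m n i, lead m n j)) := fun i j => rfl
  have h1 := map_qDet_mul (q := q⁻¹) f
    ((big q k m n true).submatrix (lead (k := k) m n) (lead m n)) (fun i j x => by
      rw [Matrix.submatrix_apply, hf, hf, hf, hgen, locOmega_even_mul, locOmega_gen,
        MulOpposite.op_mul]
      simp [locPar, lead, par_castAdd]) e'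
  have h2 : ((big q k m n true).submatrix (lead (k := k) m n) (lead m n)).map f =
      ((big q k m n false).submatrix (lead (k := k) m n) (lead m n)).map MulOpposite.op := by
    ext i j
    rw [Matrix.map_apply, Matrix.submatrix_apply, hf, hgen, locOmega_gen]
    rfl
  rw [he', h2, (isQManin_lead_false q k m n).qDet_op, hf, hf, locOmega_one,
    ← MulOpposite.op_mul] at h1
  have h3 := MulOpposite.op_injective h1
  exact isUnit_iff_exists_and_exists.2 ⟨⟨e, he⟩, ⟨_, h3.symm⟩⟩

end Localization

end SuperManin

theorem theorem4p11 {K : Type*} [Field K] (q : Kˣ) (k m n : ℕ) :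
    IsUnit ((SuperManin.big q k m n false).submatrix (SuperManin.lead m n)
      (SuperManin.lead (k := k) m n)) ∧
    (∀ i j : Fin (m + n), SuperManin.psi q k m n (SuperManin.gen q m n false i j) =
      SuperManin.quasidet ((SuperManin.big q k m n false).submatrix (SuperManin.border i)
        (SuperManin.border (k := k) j)) (Fin.last k) (Fin.last k)) ∧
    ∃ d : (SuperManin.Loc q k m n)ˣ,
      (d : SuperManin.Loc q k m n) =
        SuperManin.qDet q ((SuperManin.big q k m n false).submatrix (SuperManin.lead m n)
          (SuperManin.lead (k := k) m n)) ∧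
      SuperManin.psi q k m n (SuperManin.Ber q m n) =
        ((d⁻¹ : (SuperManin.Loc q k m n)ˣ) : SuperManin.Loc q k m n) *
          SuperManin.toLoc q k m n (SuperManin.Ber q (k + m) n) := by
  obtain ⟨T, hT, hT', hZ⟩ := SuperManin.exists_inverse_lead q k m n
  refine ⟨isUnit_iff_exists.2 ⟨T, hT, hT'⟩, fun i j => ?_, ?_⟩
  · have hb : ∀ (i : Fin (m + n)) (a : Fin k),
        SuperManin.border (k := k) i ((Fin.last k).succAbove a) = SuperManin.lead m n a := by
      intro i a
      rw [Fin.succAbove_last, SuperManin.border, Fin.lastCases_castSucc]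
    have hl : ∀ i : Fin (m + n), SuperManin.border (k := k) i (Fin.last k) =
        SuperManin.shift k i := by
      intro i
      rw [SuperManin.border, Fin.lastCases_last]
    have hA : ((SuperManin.big q k m n false).submatrix (SuperManin.border i)
        (SuperManin.border (k := k) j)).submatrix (Fin.last k).succAbove (Fin.last k).succAbove =
        (SuperManin.big q k m n false).submatrix (SuperManin.lead m n)
          (SuperManin.lead (k := k) m n) := by
      ext a b
      simp only [Matrix.submatrix_apply, hb]
    have hinv : Ring.inverse ((SuperManin.big q k m n false).submatrix (SuperManin.lead m n)
        (SuperManin.lead (k := k) m n)) = T :=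
      Ring.inverse_unit ⟨_, T, hT, hT'⟩
    rw [SuperManin.quasidet, hA, hinv, SuperManin.psi_gen, hZ, if_neg (by simp)]
    simp only [Matrix.submatrix_apply, hb, hl, Matrix.sub_apply, Matrix.mul_apply,
      Finset.sum_mul]
    rw [Finset.sum_comm]
  · obtain ⟨d, hd⟩ := SuperManin.isUnit_qDet_lead q k m n
    refine ⟨d, hd, ?_⟩
    rw [Units.eq_inv_mul_iff_mul_eq, hd, SuperManin.psi_Ber, SuperManin.toLoc_Ber,
      SuperManin.qBer, SuperManin.qBer, ← mul_assoc]
    have hE := SuperManin.isQManin_even fun x y h =>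
      SuperManin.big_rel q k m n x y (.manin h)
    have hs := hE.qDet_schur hT
    rw [hs]
    congr 2
    · rw [hZ]
      rfl
    · ext i j
      have hi : ∀ i : Fin n, SuperManin.shift k (Fin.natAdd m i) = Fin.natAdd (k + m) i :=
        fun i => Fin.ext (Nat.add_assoc k m i).symm
      simp only [Matrix.submatrix_apply, hi]
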